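/- There is a universal constant $c>0$ such that the following holds for all $L>0$ and $\gamma>0$. For an integer $k\ge 0$ let $\dot H^k_{\rm per}$ denote the space of real-valued $L$-periodic functions on $\mathbb{R}$ with mean zero over a period whose weak (distributional) derivatives on $\mathbb{R}/L\mathbb{Z}$ of all orders $0\le j\le k$ are square integrable over a period, and write $|g|=\bigl(\int_0^L g^2\,dx\bigr)^{1/2}$. Then for every $f\in\dot H^2_{\rm per}$ there is a function $u^*\in\dot H^5_{\rm per}$ with $$|u^*|\le \frac{|f|}{\gamma},\qquad |u^*_{xxx}|^2\le 2c\Bigl(\frac{|f|}{\gamma}\Bigr)^6+16|f|^2,$$ which solves the stationary damped and driven KdV equation $$u^*u^*_x+u^*_{xxx}+\gamma u^*=f$$ in the classical sense: $u^*$ is three times continuously differentiable and the equation holds at every point $x\in\mathbb{R}$, where $f$ is identified with its continuously differentiable representative (which exists since $f\in\dot H^2_{\rm per}$). -/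

import Mathlib

open MeasureTheory
open scoped ContDiff

noncomputable section

namespace PeriodicKdV

/-- The `L²` norm over one period, `|u| = (∫₀ᴸ u²)^{1/2}`. -/
def l2Norm (L : ℝ) (u : ℝ → ℝ) : ℝ :=
  Real.sqrt (∫ x in (0 : ℝ)..L, u x ^ 2)

/-- `u` is square integrable over one period. -/
def IsL2 (L : ℝ) (u : ℝ → ℝ) : Prop :=
  MemLp u 2 (volume.restrict (Set.Ioc 0 L))

/-- `v` is the weak derivative of order `k` of `u` on the circle `ℝ / Lℤ`: the defining
integration by parts formula holds against every smooth `L`-periodic test function. -/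
def HasWeakDeriv (L : ℝ) (k : ℕ) (u v : ℝ → ℝ) : Prop :=
  ∀ φ : ℝ → ℝ, ContDiff ℝ ∞ φ → Function.Periodic φ L →
    ∫ x in (0 : ℝ)..L, u x * iteratedDeriv k φ x = (-1) ^ k * ∫ x in (0 : ℝ)..L, v x * φ x

/-- `u` belongs to the space of real, `L`-periodic, mean-zero functions whose weak derivatives of
all orders `j ≤ k` are square integrable over a period. -/
structure MemHDotPer (L : ℝ) (k : ℕ) (u : ℝ → ℝ) : Prop where
  periodic : Function.Periodic u L
  isL2 : IsL2 L u
  mean_zero : ∫ x in (0 : ℝ)..L, u x = 0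
  weakDeriv : ∀ j : ℕ, j ≤ k →
    ∃ v : ℝ → ℝ, Function.Periodic v L ∧ IsL2 L v ∧ HasWeakDeriv L j u v

/-- The stationary damped and driven KdV equation `u u_x + u_xxx + γ u = f` holds in the classical
sense: `u` has continuous derivatives up to order three and the equation holds at every point. -/
def IsClassicalSteadyState (γ : ℝ) (f u : ℝ → ℝ) : Prop :=
  ContDiff ℝ 3 u ∧ ∀ x : ℝ, u x * deriv u x + iteratedDeriv 3 u x + γ * u x = f x

end PeriodicKdV

end

/-! In Fourier coefficients on the circle, with `κ = 2π / L`, the equation reads `(iκk/2) (c * c)ₖ +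
((iκk)³ + γ) cₖ = fₖ`. Restricted to `|k| ≤ N` it is the zero set of a polynomial vector field on
`ℂ^N`. Paired with `c`, the convective term cancels (`sum_mul_conv_self_eq_zero`) and the dispersive
term is skew, so only damping and forcing survive and the field points outwards on a large sphere.
The Brouwer-type lemma `exists_zero_of_inner_pos` then gives a solution whose `ℓ²` norm is bounded
independently of `N` (`exists_truncated_solution`).

The cubic symbol outweighs the single derivative in the nonlinearity (`dispersive_bound`). An `ℓ²`
bound on `c` bounds `c * c` uniformly, hence `cₖ = O(k⁻²)` uniformly in `N`. This gives compactness
mode by mode and a dominated passage to the limit in the convolution; bootstrapping improves the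
decay of the limit to `k⁻⁵` (`exists_fourier_solution`), enough to differentiate its series three
times (`exists_classical_solution`).

The sharp estimates are not carried through the limit: `steadyState_bounds` proves them for every
classical periodic solution. Testing with `u` gives `|u| ≤ |f| / γ`; testing with `u_xxx` gives
`|u_xxx| ≤ |f| + |u u_x|`, and Agmon's inequality with interpolation gives `|u u_x|² ≤ 2 |u|³
|u_xxx|`. Membership in `H⁵` is read off from `u_xxx = f - u u_x - γ u`, whose right side has two
weak derivatives (`memHDotPer_five_of_steadyState`). -/

/-! ### Zeros of outward-pointing vector fields in finite dimension. -/

section CoerciveZero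

open Metric Polynomial

/-- Polynomial interpolation of `t ↦ det (1 + t A)` with weights independent of `A`. -/
theorem exists_weights_det_one_add {E : Type*} [NormedAddCommGroup E] [NormedSpace ℝ E]
    [FiniteDimensional ℝ E] {ε : ℝ} (hε : 0 < ε) :
    ∃ (t w : ℕ → ℝ) (n : ℕ), (∀ i, 0 < t i ∧ t i < ε) ∧ ∑ i ∈ Finset.range n, w i = 1 ∧
      ∀ A : E →L[ℝ] E, (1 + A).det = ∑ i ∈ Finset.range n, w i * (1 + t i • A).det := by
  classical
  set d := Module.finrank ℝ E
  -- Distinct nodes in `(0, ε)`. The determinant has degree at most `d` in `t`, so `d + 1` of them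
  -- determine its value at `1`.
  let t : ℕ → ℝ := fun i => ε / (i + 2)
  have ht : Function.Injective t := by
    intro i j hij
    have h1 : (i : ℝ) + 2 ≠ 0 := by positivity
    have h2 : (j : ℝ) + 2 ≠ 0 := by positivity
    simp only [t] at hij
    rw [div_eq_div_iff h1 h2] at hij
    have := mul_left_cancel₀ hε.ne' hij
    have h3 : (i : ℝ) = j := by linarith
    exact_mod_cast h3
  have hinj : Set.InjOn t (Finset.range (d + 1) : Set ℕ) := ht.injOn
  refine ⟨t, fun i => (Lagrange.basis (Finset.range (d + 1)) t i).eval 1, d + 1, ?_, ?_, ?_⟩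
  · intro i
    refine ⟨by positivity, ?_⟩
    have : (1 : ℝ) < i + 2 := by have : (0 : ℝ) ≤ i := Nat.cast_nonneg i
                                 linarith
    exact div_lt_self hε this
  · have := Lagrange.sum_basis hinj ⟨0, by simp⟩
    rw [← Polynomial.eval_finsetSum, this, Polynomial.eval_one]
  · intro A
    let b := Module.finBasis ℝ E
    let M := LinearMap.toMatrix b b (A : E →ₗ[ℝ] E)
    let p : ℝ[X] := Matrix.det ((X : ℝ[X]) • M.map C + (1 : Matrix (Fin d) (Fin d) ℝ).map C)
    have hp : ∀ s : ℝ, p.eval s = (1 + s • A).det := by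
      intro s
      rw [ContinuousLinearMap.det, ← LinearMap.det_toMatrix b]
      have : LinearMap.toMatrix b b ((1 + s • A : E →L[ℝ] E) : E →ₗ[ℝ] E) = s • M + 1 := by
        rw [ContinuousLinearMap.toLinearMap_add, ContinuousLinearMap.toLinearMap_smul, map_add, map_smul,
          add_comm]
        congr 1
        exact LinearMap.toMatrix_one b
      rw [this]
      simp only [p]
      rw [← Polynomial.coe_evalRingHom, RingHom.map_det]
      congr 1
      ext i j
      by_cases hij : i = j <;> simp [hij, mul_comm s]
    have hdeg : p.degree < (Finset.range (d + 1)).card := by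
      rw [Finset.card_range]
      refine lt_of_le_of_lt Polynomial.degree_le_natDegree ?_
      have := Polynomial.natDegree_det_X_add_C_le M (1 : Matrix (Fin d) (Fin d) ℝ)
      rw [Fintype.card_fin] at this
      exact_mod_cast Nat.lt_succ_of_le this
    have hint := Lagrange.eq_interpolate hinj hdeg
    have h1 := hp 1
    rw [one_smul] at h1
    rw [← h1]
    conv_lhs => rw [hint]
    rw [Lagrange.interpolate_apply, Polynomial.eval_finsetSum]
    refine Finset.sum_congr rfl fun i _ => ?_
    rw [Polynomial.eval_mul, Polynomial.eval_C, hp, mul_comm]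

/-- Along the segment from `1` to `1 + A` every operator is invertible by the Neumann series, so the
determinant cannot change sign from its value `1` at the identity. -/
theorem det_one_add_pos_of_norm_lt_one {E : Type*} [NormedAddCommGroup E] [NormedSpace ℝ E]
    [FiniteDimensional ℝ E] {A : E →L[ℝ] E} (hA : ‖A‖ < 1) : 0 < (1 + A).det := by
  have : CompleteSpace E := FiniteDimensional.complete ℝ E
  have hne : ∀ s ∈ Set.Icc (0 : ℝ) 1, (1 + s • A).det ≠ 0 := by
    intro s hs
    have h1 : ‖-(s • A)‖ < 1 := by
      rw [norm_neg, norm_smul, Real.norm_eq_abs, abs_of_nonneg hs.1]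
      nlinarith [hs.2, norm_nonneg A, hs.1]
    have h2 := isUnit_one_sub_of_norm_lt_one h1
    rw [sub_neg_eq_add] at h2
    have h3 : IsUnit ((1 + s • A : E →L[ℝ] E) : E →ₗ[ℝ] E) :=
      h2.map (ContinuousLinearMap.toLinearMapRingHom (R₁ := ℝ) (M₁ := E))
    exact ((LinearMap.isUnit_iff_isUnit_det _).1 h3).ne_zero
  have hcont : ContinuousOn (fun s : ℝ => (1 + s • A).det) (Set.Icc 0 1) := by
    apply Continuous.continuousOn
    exact ContinuousLinearMap.continuous_det.comp (by fun_prop)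
  by_contra hneg
  push Not at hneg
  have h0 : (1 + (0 : ℝ) • A).det = 1 := by
    rw [zero_smul, add_zero]
    exact LinearMap.det_id
  have := intermediate_value_Icc' zero_le_one hcont
  have hmem : (0 : ℝ) ∈ Set.Icc ((1 + (1 : ℝ) • A).det) ((1 + (0 : ℝ) • A).det) := by
    rw [h0, one_smul]; exact ⟨hneg, zero_le_one⟩
  obtain ⟨s, hs, hs0⟩ := this hmem
  exact hne s hs hs0

/-- Extending by zero a function that is Lipschitz on the unit ball and vanishes on the sphere. -/
theorem lipschitzWith_extend_zero {E : Type*} [NormedAddCommGroup E] [NormedSpace ℝ E]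
    {h : E → E} {K : NNReal} (hK : LipschitzOnWith K h (closedBall 0 1))
    (h0 : ∀ x, ‖x‖ = 1 → h x = 0) :
    LipschitzWith K (fun x => if ‖x‖ ≤ 1 then h x else 0) := by
  have key : ∀ x y : E, ‖x‖ ≤ 1 → 1 < ‖y‖ → dist (h x) 0 ≤ K * dist x y := by
    intro x y hx hy
    have hpre : IsPreconnected (segment ℝ x y) := (convex_segment x y).isPreconnected
    obtain ⟨z, hz, hz1⟩ := hpre.intermediate_value (left_mem_segment ℝ x y)
      (right_mem_segment ℝ x y) continuous_norm.continuousOn ⟨hx, hy.le⟩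
    have h1 := dist_add_dist_of_mem_segment hz
    have h2 := hK.dist_le_mul x (by simpa using hx) z (by simpa using hz1.le)
    rw [h0 z hz1] at h2
    refine h2.trans ?_
    gcongr
    linarith [dist_nonneg (x := z) (y := y)]
  refine LipschitzWith.of_dist_le_mul fun x y => ?_
  by_cases hx : ‖x‖ ≤ 1 <;> by_cases hy : ‖y‖ ≤ 1
  · simp only [hx, hy, if_true]
    exact hK.dist_le_mul x (by simpa using hx) y (by simpa using hy)
  · simp only [hx, hy, if_true, if_false]
    exact key x y hx (not_le.1 hy)
  · simp only [hx, hy, if_true, if_false]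
    rw [dist_comm, dist_comm x y]
    exact key y x hy (not_le.1 hx)
  · simp only [hx, hy, if_false, dist_self]
    positivity

/-- There is no `C¹` retraction of the unit ball onto the unit sphere. -/
theorem no_retraction {E : Type*} [NormedAddCommGroup E] [InnerProductSpace ℝ E]
    [FiniteDimensional ℝ E] {h : E → E} (hd : ∀ x ∈ closedBall (0 : E) 1, ContDiffAt ℝ 1 h x)
    (h0 : ∀ x, ‖x‖ = 1 → h x = 0) (h1 : ∀ x ∈ closedBall (0 : E) 1, ‖x + h x‖ = 1) : False := by
  let _ : MeasurableSpace E := borel E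
  have : BorelSpace E := ⟨rfl⟩
  let μ : Measure E := Measure.addHaar
  have hfc : ContinuousOn (fderiv ℝ h) (closedBall (0 : E) 1) := fun x hx =>
    ((hd x hx).continuousAt_fderiv one_ne_zero).continuousWithinAt
  obtain ⟨K₀, hK₀⟩ := (isCompact_closedBall (0 : E) 1).exists_bound_of_continuousOn hfc
  let K : NNReal := ⟨max K₀ 0 + 1, by positivity⟩
  have hKpos : (0 : ℝ) < K := by
    change (0 : ℝ) < max K₀ 0 + 1
    positivity
  have hKb : ∀ x ∈ closedBall (0 : E) 1, ‖fderiv ℝ h x‖ ≤ K := fun x hx =>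
    (hK₀ x hx).trans (by change K₀ ≤ max K₀ 0 + 1
                         linarith [le_max_left K₀ 0])
  have hLip : LipschitzOnWith K h (closedBall 0 1) :=
    (convex_closedBall (0 : E) 1).lipschitzOnWith_of_nnnorm_fderiv_le
      (fun x hx => (hd x hx).differentiableAt one_ne_zero) (fun x hx => hKb x hx)
  have hH := lipschitzWith_extend_zero hLip h0
  set H : E → E := fun x => if ‖x‖ ≤ 1 then h x else 0 with hHdef
  -- For small `t` the map `x + t • H x` is a Lipschitz perturbation of the identity, hence a
  -- bijection of `E`. It fixes everything outside the open ball, so it maps the ball onto itself,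
  -- and the change of variables preserves volume.
  have hvol : ∀ t : ℝ, 0 < t → t < 1 / K →
      ∫ x in ball (0 : E) 1, (1 + t • fderiv ℝ h x).det ∂μ = μ.real (ball 0 1) := by
    intro t ht htK
    have htK' : t * K < 1 := by rwa [lt_div_iff₀ hKpos] at htK
    let F : E → E := fun x => x + t • H x
    have happ : ApproximatesLinearOn F ((ContinuousLinearEquiv.refl ℝ E : E ≃L[ℝ] E) : E →L[ℝ] E)
        Set.univ (t.toNNReal * K) := by
      intro x _ y _
      have : F x - F y - ((ContinuousLinearEquiv.refl ℝ E : E ≃L[ℝ] E) : E →L[ℝ] E) (x - y)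
          = t • (H x - H y) := by
        simp only [F, smul_sub, ContinuousLinearEquiv.coe_refl, ContinuousLinearMap.coe_id', id]
        abel
      rw [this, norm_smul, Real.norm_eq_abs, abs_of_pos ht, NNReal.coe_mul,
        Real.coe_toNNReal t ht.le, mul_assoc]
      gcongr
      simpa [dist_eq_norm] using hH.dist_le_mul x y
    have hc : Subsingleton E ∨ t.toNNReal * K <
        ‖((ContinuousLinearEquiv.refl ℝ E : E ≃L[ℝ] E).symm : E →L[ℝ] E)‖₊⁻¹ := by
      rcases subsingleton_or_nontrivial E with hs | hs
      · exact Or.inl hs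
      · right
        have : ‖((ContinuousLinearEquiv.refl ℝ E : E ≃L[ℝ] E).symm : E →L[ℝ] E)‖₊ = 1 := by
          rw [ContinuousLinearEquiv.refl_symm, ContinuousLinearEquiv.coe_refl]
          exact NNReal.eq ContinuousLinearMap.norm_id
        rw [this, inv_one]
        rwa [← NNReal.coe_lt_coe, NNReal.coe_mul, Real.coe_toNNReal t ht.le, NNReal.coe_one]
    have hinj : Function.Injective F := Set.injOn_univ.1 (happ.injOn hc)
    have hsurj : Function.Surjective F := happ.surjective hc
    have hout : ∀ x : E, 1 ≤ ‖x‖ → F x = x := by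
      intro x hx
      rcases hx.eq_or_lt with hx | hx
      · simp [F, H, hx.symm.le, h0 x hx.symm]
      · simp [F, H, not_le.2 hx]
    have himg : F '' ball 0 1 = ball 0 1 := by
      ext y
      constructor
      · rintro ⟨x, hx, rfl⟩
        by_contra hy
        have hy' : 1 ≤ ‖F x‖ := by simpa using hy
        have h2 := hinj (hout _ hy')
        rw [h2] at hy'
        rw [mem_ball_zero_iff] at hx
        linarith
      · intro hy
        obtain ⟨x, rfl⟩ := hsurj y
        refine ⟨x, ?_, rfl⟩
        by_contra hx
        have hx' : 1 ≤ ‖x‖ := by simpa using hx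
        rw [hout x hx'] at hy
        exact hx hy
    have hder : ∀ x ∈ ball (0 : E) 1, HasFDerivWithinAt F (1 + t • fderiv ℝ h x) (ball 0 1) x := by
      intro x hx
      have hdx := ((hd x (ball_subset_closedBall hx)).differentiableAt one_ne_zero).hasFDerivAt
      have h2 : HasFDerivAt (fun y => y + t • h y) (1 + t • fderiv ℝ h x) x :=
        (hasFDerivAt_id x).add (hdx.const_smul t)
      refine h2.hasFDerivWithinAt.congr ?_ ?_
      · intro y hy
        have : ‖y‖ ≤ 1 := (mem_ball_zero_iff.1 hy).le
        simp [F, H, this]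
      · have : ‖x‖ ≤ 1 := (mem_ball_zero_iff.1 hx).le
        simp [F, H, this]
    have hcv := integral_image_eq_integral_abs_det_fderiv_smul μ measurableSet_ball hder
      hinj.injOn (fun _ => (1 : ℝ))
    rw [himg] at hcv
    rw [setIntegral_const, smul_eq_mul, mul_one] at hcv
    rw [hcv]
    refine setIntegral_congr_fun measurableSet_ball fun x hx => ?_
    have hpos : 0 < (1 + t • fderiv ℝ h x).det := by
      apply det_one_add_pos_of_norm_lt_one
      rw [norm_smul, Real.norm_eq_abs, abs_of_pos ht]
      refine lt_of_le_of_lt ?_ htK'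
      gcongr
      exact hKb x (ball_subset_closedBall hx)
    simp [abs_of_pos hpos]
  obtain ⟨t, w, n, ht, hw, hdet⟩ := exists_weights_det_one_add (E := E) (one_div_pos.2 hKpos)
  -- The map `x + h x` takes values in the sphere, so its differential has range orthogonal to `x +
  -- h x`. If it were invertible, `x + h x` would lie in that range and be orthogonal to itself.
  have hzero : ∀ x ∈ ball (0 : E) 1, (1 + fderiv ℝ h x).det = 0 := by
    intro x hx
    by_contra hne
    have hdx := ((hd x (ball_subset_closedBall hx)).differentiableAt one_ne_zero).hasFDerivAt
    have h2 : HasFDerivAt (fun y => y + h y) (1 + fderiv ℝ h x) x := (hasFDerivAt_id x).add hdx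
    have h3 := h2.inner ℝ h2
    have h4 : HasFDerivAt (fun y => inner ℝ (y + h y) (y + h y)) (0 : E →L[ℝ] ℝ) x := by
      refine (hasFDerivAt_const (1 : ℝ) x).congr_of_eventuallyEq ?_
      filter_upwards [isOpen_ball.mem_nhds hx] with y hy
      rw [real_inner_self_eq_norm_sq, h1 y (ball_subset_closedBall hy), one_pow]
    have h5 := h3.unique h4
    have hu : IsUnit ((1 + fderiv ℝ h x : E →L[ℝ] E) : E →ₗ[ℝ] E) :=
      (LinearMap.isUnit_iff_isUnit_det _).2 (isUnit_iff_ne_zero.2 hne)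
    obtain ⟨v, hv⟩ := ((Module.End.isUnit_iff _).1 hu).2 (x + h x)
    have hv' : (1 + fderiv ℝ h x) v = x + h x := hv
    have h6 := DFunLike.congr_fun h5 v
    simp only [ContinuousLinearMap.comp_apply, fderivInnerCLM_apply, ContinuousLinearMap.prod_apply,
      hv', zero_apply] at h6
    rw [real_inner_self_eq_norm_sq, h1 x (ball_subset_closedBall hx)] at h6
    norm_num at h6
  have hcontdet : ∀ s : ℝ, IntegrableOn (fun x => (1 + s • fderiv ℝ h x).det) (ball (0 : E) 1) μ := by
    intro s
    refine IntegrableOn.mono_set ?_ ball_subset_closedBall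
    refine ContinuousOn.integrableOn_compact (isCompact_closedBall 0 1) ?_
    exact ContinuousLinearMap.continuous_det.comp_continuousOn
      (continuousOn_const.add (hfc.const_smul s))
  -- The interpolation weights do not depend on `x`, so the volume identity passes from small `t` to
  -- `t = 1`, where the integrand vanishes.
  have hsum : ∫ x in ball (0 : E) 1, (1 + fderiv ℝ h x).det ∂μ = μ.real (ball 0 1) := by
    rw [setIntegral_congr_fun measurableSet_ball fun x _ => hdet (fderiv ℝ h x)]
    rw [integral_finsetSum _ fun i _ => (hcontdet (t i)).const_mul (w i)]
    simp_rw [integral_const_mul]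
    rw [Finset.sum_congr rfl fun i _ => by rw [hvol (t i) (ht i).1 (ht i).2], ← Finset.sum_mul, hw,
      one_mul]
  rw [setIntegral_congr_fun measurableSet_ball hzero] at hsum
  simp only [integral_zero] at hsum
  have : 0 < μ.real (ball (0 : E) 1) :=
    ENNReal.toReal_pos (measure_ball_pos μ _ one_pos).ne' measure_ball_lt_top.ne
  linarith

/-- A `C¹` vector field that points outwards on the unit sphere vanishes in the unit ball. -/
theorem exists_zero_unit_ball {E : Type*} [NormedAddCommGroup E] [InnerProductSpace ℝ E]
    [FiniteDimensional ℝ E] {P : E → E} (hP : ContDiff ℝ 1 P)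
    (hpos : ∀ x, ‖x‖ = 1 → 0 < inner ℝ (P x) x) : ∃ x, ‖x‖ ≤ 1 ∧ P x = 0 := by
  by_contra hno
  push Not at hno
  let a : E → ℝ := fun x => inner ℝ (P x) (P x)
  let b : E → ℝ := fun x => inner ℝ (P x) x
  let D : E → ℝ := fun x => b x ^ 2 + a x * (1 - inner ℝ x x)
  -- The larger root of `‖x + l • P x‖² = 1`, with `D` a quarter of the discriminant. On the sphere
  -- `D = b²` with `b > 0`, so this root is `0` and the retraction fixes the sphere.
  let l : E → ℝ := fun x => (-b x + Real.sqrt (D x)) / a x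
  have ha : ∀ x ∈ closedBall (0 : E) 1, 0 < a x := fun x hx => by
    have := hno x (by simpa using hx)
    exact real_inner_self_pos.2 this
  have hD : ∀ x ∈ closedBall (0 : E) 1, 0 < D x := by
    intro x hx
    have hax := ha x hx
    have hx' : ‖x‖ ≤ 1 := by simpa using hx
    simp only [D, real_inner_self_eq_norm_sq x]
    rcases hx'.eq_or_lt with h | h
    · have : 0 < b x := hpos x h
      rw [h]
      have : 0 < b x ^ 2 := by positivity
      linarith
    · have : 0 < 1 - ‖x‖ ^ 2 := by nlinarith [norm_nonneg x]
      have := mul_pos hax this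
      nlinarith [sq_nonneg (b x)]
  have hac : ContDiff ℝ 1 a := hP.inner ℝ hP
  have hbc : ContDiff ℝ 1 b := hP.inner ℝ contDiff_id
  have hDc : ContDiff ℝ 1 D :=
    (hbc.pow 2).add (hac.mul (contDiff_const.sub (contDiff_id.inner ℝ contDiff_id)))
  refine no_retraction (h := fun x => l x • P x) ?_ ?_ ?_
  · intro x hx
    have h1 : ContDiffAt ℝ 1 (fun x => Real.sqrt (D x)) x := hDc.contDiffAt.sqrt (hD x hx).ne'
    exact ((hbc.neg.contDiffAt.add h1).div hac.contDiffAt (ha x hx).ne').smul hP.contDiffAt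
  · intro x hx
    have : 0 < b x := hpos x hx
    have h2 : D x = b x ^ 2 := by simp only [D, real_inner_self_eq_norm_sq x, hx]; ring
    simp only [l, h2, Real.sqrt_sq this.le, neg_add_cancel, zero_div, zero_smul]
  · intro x hx
    have hax := ha x hx
    have hs := Real.sq_sqrt (hD x hx).le
    have h2 : ‖x + l x • P x‖ ^ 2 = 1 := by
      rw [norm_add_sq_real, norm_smul, mul_pow, real_inner_smul_right, Real.norm_eq_abs, sq_abs,
        ← real_inner_self_eq_norm_sq x, ← real_inner_self_eq_norm_sq (P x), real_inner_comm (P x) x]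
      change inner ℝ x x + 2 * (l x * b x) + l x ^ 2 * a x = 1
      have hl : l x * a x = -b x + Real.sqrt (D x) := div_mul_cancel₀ _ hax.ne'
      have h3 : (l x * a x + b x) ^ 2 = D x := by
        rw [hl, neg_add_eq_sub, sub_add_cancel, hs]
      have h4 : a x * (inner ℝ x x + 2 * (l x * b x) + l x ^ 2 * a x) = a x * 1 := by
        have : D x = b x ^ 2 + a x * (1 - inner ℝ x x) := rfl
        rw [this] at h3
        linarith
      exact mul_left_cancel₀ hax.ne' h4
    have h3 : ‖x + l x • P x‖ ^ 2 = 1 ^ 2 := by rw [h2, one_pow]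
    exact (pow_left_inj₀ (norm_nonneg _) zero_le_one two_ne_zero).1 h3

/-- A `C¹` vector field that points outwards on a sphere vanishes somewhere inside. -/
theorem exists_zero_of_inner_pos {E : Type*} [NormedAddCommGroup E] [InnerProductSpace ℝ E]
    [FiniteDimensional ℝ E] {P : E → E} (hP : ContDiff ℝ 1 P) {R : ℝ} (hR : 0 < R)
    (hpos : ∀ x, ‖x‖ = R → 0 < inner ℝ (P x) x) : ∃ x, ‖x‖ ≤ R ∧ P x = 0 := by
  have hQ : ContDiff ℝ 1 (fun x => P (R • x)) := hP.comp (contDiff_id.const_smul R)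
  obtain ⟨x, hx, hx0⟩ := exists_zero_unit_ball hQ fun x hx => by
    have h1 := hpos (R • x) (by rw [norm_smul, hx, mul_one, Real.norm_eq_abs, abs_of_pos hR])
    rw [real_inner_smul_right] at h1
    exact (pos_iff_pos_of_mul_pos h1).1 hR
  refine ⟨R • x, ?_, hx0⟩
  rw [norm_smul, Real.norm_eq_abs, abs_of_pos hR]
  nlinarith

end CoerciveZero

/-! ### Galerkin truncation in Fourier modes. -/

section Galerkin

open Complex ComplexConjugate

/-- Convolution of sequences indexed by `ℤ`. -/
noncomputable def conv (c d : ℤ → ℂ) (k : ℤ) : ℂ := ∑' j, c j * d (k - j)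

theorem conv_eq_sum {c d : ℤ → ℂ} {s : Finset ℤ} (hc : ∀ k, k ∉ s → c k = 0) (k : ℤ) :
    conv c d k = ∑ j ∈ s, c j * d (k - j) :=
  tsum_eq_sum fun j hj => by rw [hc j hj, zero_mul]

theorem conv_neg {c d : ℤ → ℂ} (hc : ∀ k, c (-k) = conj (c k)) (hd : ∀ k, d (-k) = conj (d k))
    (k : ℤ) : conv c d (-k) = conj (conv c d k) := by
  unfold conv
  rw [conj_tsum, ← (Equiv.neg ℤ).tsum_eq]
  refine tsum_congr fun j => ?_
  rw [Equiv.neg_apply, hc, ← neg_sub', hd, map_mul]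

theorem sum_Icc_neg_self {M : Type*} [AddCommMonoid M] (g : ℤ → M) (N : ℕ) :
    ∑ k ∈ Finset.Icc (-(N : ℤ)) N, g k
      = g 0 + ∑ i ∈ Finset.range N, (g (i + 1) + g (-(i + 1))) := by
  induction N with
  | zero => simp
  | succ n ih =>
    have : Finset.Icc (-((n + 1 : ℕ) : ℤ)) ((n + 1 : ℕ) : ℤ)
        = insert ((n : ℤ) + 1) (insert (-((n : ℤ) + 1)) (Finset.Icc (-(n : ℤ)) n)) := by
      ext k; simp only [Finset.mem_Icc, Finset.mem_insert]; push_cast; omega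
    rw [this, Finset.sum_insert, Finset.sum_insert, ih, Finset.sum_range_succ]
    · abel
    · simp
    · simp; omega

/-- Cancellation in the convective term: `∑ k c₋ₖ (c * c)ₖ = 0`. -/
theorem sum_mul_conv_self_eq_zero {c : ℤ → ℂ} {N : ℕ} (hc : ∀ k, (N : ℤ) < |k| → c k = 0) :
    ∑ k ∈ Finset.Icc (-(N : ℤ)) N, (k : ℂ) * (c (-k) * conv c c k) = 0 := by
  set s := Finset.Icc (-(N : ℤ)) N
  have hcs : ∀ k, k ∉ s → c k = 0 := fun k hk => hc k (by
    by_contra h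
    exact hk (Finset.mem_Icc.2 (abs_le.1 (not_lt.1 h))))
  -- The product is symmetric in three frequencies summing to zero, so the weight `a` may be
  -- replaced by `b` or by `-a - b`. The three weights add up to `0`, whence `3 * A = 0`.
  let A : ℂ := ∑ a ∈ s, ∑ b ∈ s, (a : ℂ) * (c a * c b * c (-a - b))
  have h1 : ∑ k ∈ s, (k : ℂ) * (c (-k) * conv c c k) = -A := by
    simp only [A]
    rw [← Finset.sum_neg_distrib]
    refine Finset.sum_nbij' (fun k => -k) (fun k => -k) ?_ ?_ (by simp) (by simp) ?_
    · intro k hk; simp only [s, Finset.mem_Icc] at *; omega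
    · intro k hk; simp only [s, Finset.mem_Icc] at *; omega
    · intro k _
      rw [conv_eq_sum hcs, Finset.mul_sum, Finset.mul_sum, ← Finset.sum_neg_distrib]
      refine Finset.sum_congr rfl fun j _ => ?_
      rw [neg_neg]; push_cast; ring
  have h2 : A = ∑ a ∈ s, ∑ b ∈ s, (b : ℂ) * (c a * c b * c (-a - b)) := by
    simp only [A]
    rw [Finset.sum_comm]
    refine Finset.sum_congr rfl fun a _ => Finset.sum_congr rfl fun b _ => ?_
    rw [show -b - a = -a - b by ring, mul_comm (c b)]
  have h3 : A = ∑ a ∈ s, ∑ b ∈ s, (-(a : ℂ) - b) * (c a * c b * c (-a - b)) := by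
    simp only [A]
    rw [Finset.sum_comm, Finset.sum_comm (s := s) (t := s)
      (f := fun a b : ℤ => (-(a : ℂ) - b) * (c a * c b * c (-a - b)))]
    refine Finset.sum_congr rfl fun b _ => ?_
    -- The window `s` is not stable under `a ↦ -a - b`, so the substitution is made in the sum over
    -- all of `ℤ`.
    rw [← tsum_eq_sum (L := .unconditional ℤ) (f := fun a : ℤ => (a : ℂ) * (c a * c b * c (-a - b)))
        fun a ha => by rw [hcs a ha]; ring,
      ← tsum_eq_sum (L := .unconditional ℤ) (f := fun a : ℤ => (-(a : ℂ) - b) * (c a * c b * c (-a - b)))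
        fun a ha => by rw [hcs a ha]; ring,
      ← ((Equiv.neg ℤ).trans (Equiv.subRight b)).tsum_eq]
    refine tsum_congr fun a => ?_
    simp only [Equiv.trans_apply, Equiv.neg_apply, Equiv.subRight_apply]
    rw [show -(-a - b) - b = a by ring]
    push_cast; ring
  have h4 : 3 * A = 0 := by
    have : A + A + A = 0 := by
      nth_rewrite 3 [h3]
      nth_rewrite 2 [h2]
      simp only [A]
      rw [← Finset.sum_add_distrib, ← Finset.sum_add_distrib]
      refine Finset.sum_eq_zero fun a _ => ?_
      rw [← Finset.sum_add_distrib, ← Finset.sum_add_distrib]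
      refine Finset.sum_eq_zero fun b _ => ?_
      ring
    rw [← this]; ring
  rw [h1, (mul_eq_zero.1 h4).resolve_left (by norm_num), neg_zero]

/-- The conjugate-symmetric extension to `ℤ` of a vector of modes `1, …, N`, with zero mode `0`. -/
noncomputable def symExtend {N : ℕ} (a : EuclideanSpace ℂ (Fin N)) : ℤ → ℂ
  | Int.ofNat 0 => 0
  | Int.ofNat (m + 1) => if h : m < N then a ⟨m, h⟩ else 0
  | Int.negSucc m => conj (if h : m < N then a ⟨m, h⟩ else 0)

theorem symExtend_zero {N : ℕ} (a : EuclideanSpace ℂ (Fin N)) : symExtend a 0 = 0 := rfl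

theorem symExtend_add_one {N : ℕ} (a : EuclideanSpace ℂ (Fin N)) (i : Fin N) :
    symExtend a ((i : ℕ) + 1) = a i := by
  change (if h : (i : ℕ) < N then a ⟨i, h⟩ else 0) = a i
  simp

theorem symExtend_neg {N : ℕ} (a : EuclideanSpace ℂ (Fin N)) (k : ℤ) :
    symExtend a (-k) = conj (symExtend a k) := by
  match k with
  | Int.ofNat 0 => simp [symExtend_zero]
  | Int.ofNat (m + 1) => rfl
  | Int.negSucc m =>
    change _ = conj (conj (if h : m < N then a ⟨m, h⟩ else 0))
    rw [conj_conj]; rfl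

theorem symExtend_of_lt {N : ℕ} (a : EuclideanSpace ℂ (Fin N)) (k : ℤ) (hk : (N : ℤ) < |k|) :
    symExtend a k = 0 := by
  match k with
  | Int.ofNat 0 => rfl
  | Int.ofNat (m + 1) =>
    have : ¬ m < N := by
      have h : |((m + 1 : ℕ) : ℤ)| = ((m + 1 : ℕ) : ℤ) := abs_of_nonneg (by positivity)
      rw [Int.ofNat_eq_natCast, h] at hk; omega
    change (if h : m < N then a ⟨m, h⟩ else 0) = 0
    simp [this]
  | Int.negSucc m =>
    have : ¬ m < N := by
      rw [Int.negSucc_eq, abs_neg, abs_of_nonneg (by positivity)] at hk; omega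
    change conj (if h : m < N then a ⟨m, h⟩ else 0) = 0
    simp [this]

theorem contDiff_symExtend {N : ℕ} (k : ℤ) :
    ContDiff ℝ 1 (fun a : EuclideanSpace ℂ (Fin N) => symExtend a k) := by
  have key : ∀ m : ℕ, ContDiff ℝ 1
      (fun a : EuclideanSpace ℂ (Fin N) => if h : m < N then a ⟨m, h⟩ else 0) := by
    intro m
    by_cases h : m < N
    · simp only [h, dite_true]
      exact (((EuclideanSpace.proj ⟨m, h⟩ : EuclideanSpace ℂ (Fin N) →L[ℂ] ℂ)).restrictScalars ℝ).contDiff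
    · simp only [h, dite_false]
      exact contDiff_const
  match k with
  | Int.ofNat 0 => exact contDiff_const
  | Int.ofNat (m + 1) => exact key m
  | Int.negSucc m => exact Complex.conjCLE.contDiff.comp (key m)

theorem sum_norm_sq_symExtend {N : ℕ} (a : EuclideanSpace ℂ (Fin N)) :
    ∑ k ∈ Finset.Icc (-(N : ℤ)) N, ‖symExtend a k‖ ^ 2 = 2 * ‖a‖ ^ 2 := by
  rw [sum_Icc_neg_self, symExtend_zero, EuclideanSpace.norm_sq_eq, ← Fin.sum_univ_eq_sum_range
    (fun i : ℕ => ‖symExtend a (i + 1)‖ ^ 2 + ‖symExtend a (-(i + 1))‖ ^ 2), Finset.mul_sum]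
  simp only [symExtend_neg, symExtend_add_one, RCLike.norm_conj, norm_zero]
  rw [zero_pow two_ne_zero, zero_add]
  exact Finset.sum_congr rfl fun i _ => by ring

/-- The modes `k` and `-k` contribute equally by conjugate symmetry, so the cancellation over `ℤ`
restricts to the positive modes, which are the actual unknowns. -/
theorem sum_im_convective_eq_zero {N : ℕ} (a : EuclideanSpace ℂ (Fin N)) :
    ∑ i : Fin N, (((i : ℕ) + 1 : ℝ)) *
      (conj (a i) * conv (symExtend a) (symExtend a) ((i : ℕ) + 1)).im = 0 := by
  have h := congrArg Complex.im (sum_mul_conv_self_eq_zero (symExtend_of_lt a))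
  rw [Complex.im_sum, sum_Icc_neg_self, ← Fin.sum_univ_eq_sum_range (fun i : ℕ =>
    ((((i : ℤ) + 1 : ℤ) : ℂ) * (symExtend a (-((i : ℤ) + 1)) *
      conv (symExtend a) (symExtend a) ((i : ℤ) + 1))).im
    + (((-((i : ℤ) + 1) : ℤ) : ℂ) * (symExtend a (- -((i : ℤ) + 1)) *
      conv (symExtend a) (symExtend a) (-((i : ℤ) + 1)))).im)] at h
  have h2 : ∀ i : Fin N,
    ((((i : ℕ) : ℤ) + 1 : ℤ) * (symExtend a (-(((i : ℕ) : ℤ) + 1)) *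
      conv (symExtend a) (symExtend a) (((i : ℕ) : ℤ) + 1)) : ℂ).im
    + ((-(((i : ℕ) : ℤ) + 1) : ℤ) * (symExtend a (- -(((i : ℕ) : ℤ) + 1)) *
      conv (symExtend a) (symExtend a) (-(((i : ℕ) : ℤ) + 1))) : ℂ).im
    = 2 * ((((i : ℕ) + 1 : ℝ)) *
      (conj (a i) * conv (symExtend a) (symExtend a) ((i : ℕ) + 1)).im) := by
    intro i
    rw [neg_neg, conv_neg (symExtend_neg a) (symExtend_neg a), symExtend_neg, symExtend_add_one]
    push_cast
    have e1 : (((i : ℕ) : ℂ) + 1) = ((((i : ℕ) : ℝ) + 1 : ℝ) : ℂ) := by push_cast; rfl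
    rw [e1, ← Complex.ofReal_neg, Complex.im_ofReal_mul, Complex.im_ofReal_mul]
    simp only [Complex.mul_im, Complex.conj_re, Complex.conj_im]
    ring
  rw [Finset.sum_congr rfl fun i _ => h2 i, ← Finset.mul_sum] at h
  simp only [Int.cast_zero, zero_mul, Complex.zero_im, zero_add] at h
  linarith

/-- Solvability of the truncated stationary equation, with a bound uniform in the truncation. -/
theorem exists_truncated_solution {κ γ F : ℝ} (hγ : 0 < γ) (hF : 0 < F) {f : ℤ → ℂ}
    (hf0 : f 0 = 0) (hf : ∀ k, f (-k) = conj (f k))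
    (hfF : ∀ s : Finset ℤ, ∑ k ∈ s, ‖f k‖ ^ 2 ≤ F ^ 2) (N : ℕ) :
    ∃ c : ℤ → ℂ, (∀ k, c (-k) = conj (c k)) ∧ c 0 = 0 ∧ (∀ k, (N : ℤ) < |k| → c k = 0) ∧
      ∑ k ∈ Finset.Icc (-(N : ℤ)) N, ‖c k‖ ^ 2 ≤ 2 * (2 * F / γ) ^ 2 ∧
      ∀ k, |k| ≤ (N : ℤ) → I * κ * k / 2 * conv c c k + ((I * κ * k) ^ 3 + γ) * c k = f k := by
  have hS : ∀ a : EuclideanSpace ℂ (Fin N), ∀ k, k ∉ Finset.Icc (-(N : ℤ)) N → symExtend a k = 0 :=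
    fun a k hk => symExtend_of_lt a k (by
      by_contra h
      exact hk (Finset.mem_Icc.2 (abs_le.1 (not_lt.1 h))))
  let p : EuclideanSpace ℂ (Fin N) → Fin N → ℂ := fun a i =>
    I * κ * ((i : ℕ) + 1) / 2 * conv (symExtend a) (symExtend a) ((i : ℕ) + 1)
      + ((I * κ * ((i : ℕ) + 1)) ^ 3 + γ) * a i - f ((i : ℕ) + 1)
  let P : EuclideanSpace ℂ (Fin N) → EuclideanSpace ℂ (Fin N) := fun a => WithLp.toLp 2 (p a)
  have hP : ContDiff ℝ 1 P := by
    rw [contDiff_piLp]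
    intro i
    change ContDiff ℝ 1 (fun a => p a i)
    have e1 : ContDiff ℝ 1 (fun a : EuclideanSpace ℂ (Fin N) => a i) := by
      simpa only [symExtend_add_one] using contDiff_symExtend (N := N) ((i : ℕ) + 1)
    have e2 : ContDiff ℝ 1 (fun a : EuclideanSpace ℂ (Fin N) =>
        conv (symExtend a) (symExtend a) ((i : ℕ) + 1)) := by
      have : (fun a : EuclideanSpace ℂ (Fin N) => conv (symExtend a) (symExtend a) ((i : ℕ) + 1))
          = fun a => ∑ j ∈ Finset.Icc (-(N : ℤ)) N,
            symExtend a j * symExtend a (((i : ℕ) + 1) - j) := by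
        funext a; exact conv_eq_sum (hS a) _
      rw [this]
      exact ContDiff.sum fun j _ => (contDiff_symExtend j).mul (contDiff_symExtend _)
    exact ((contDiff_const.mul e2).add (contDiff_const.mul e1)).sub contDiff_const
  have hinner : ∀ a, inner ℝ (P a) a
      = γ * ‖a‖ ^ 2 - ∑ i : Fin N, (conj (a i) * f ((i : ℕ) + 1)).re := by
    intro a
    rw [PiLp.inner_apply, EuclideanSpace.norm_sq_eq, Finset.mul_sum]
    have hz := sum_im_convective_eq_zero a
    -- The factor `(iκk)³` is purely imaginary and drops out of the real inner product.
    have hterm : ∀ i : Fin N, inner ℝ (P a i) (a i) = γ * ‖a i‖ ^ 2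
        - (conj (a i) * f ((i : ℕ) + 1)).re - κ / 2 * ((((i : ℕ) + 1 : ℝ)) *
      (conj (a i) * conv (symExtend a) (symExtend a) ((i : ℕ) + 1)).im) := by
      intro i
      have hI : (I * κ * (((i : ℕ) : ℂ) + 1)) ^ 3 = -I * ((κ * ((i : ℕ) + 1)) ^ 3 : ℝ) := by
        push_cast
        rw [mul_assoc, mul_pow, pow_succ I 2, I_sq]; ring
      have hI2 : I * κ * (((i : ℕ) : ℂ) + 1) / 2 = I * ((κ * ((i : ℕ) + 1) / 2 : ℝ)) := by
        push_cast; ring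
      change inner ℝ (p a i) (a i) = _
      simp only [p, hI, hI2]
      rw [Complex.inner, ← Complex.normSq_eq_norm_sq, Complex.normSq_apply]
      generalize conv (symExtend a) (symExtend a) ((i : ℕ) + 1) = w
      generalize f ((i : ℕ) + 1) = g
      generalize a i = z
      simp only [Complex.mul_re, Complex.mul_im, Complex.conj_re, Complex.conj_im, Complex.add_re,
        Complex.add_im, Complex.sub_re, Complex.sub_im, Complex.I_re, Complex.I_im, Complex.ofReal_re,
        Complex.ofReal_im, Complex.neg_re, Complex.neg_im]
      ring
    rw [Finset.sum_congr rfl fun i _ => hterm i, Finset.sum_sub_distrib, Finset.sum_sub_distrib,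
      ← Finset.mul_sum _ _ (κ / 2), hz, mul_zero, sub_zero]
  have hforce : ∀ a : EuclideanSpace ℂ (Fin N),
      ∑ i : Fin N, (conj (a i) * f ((i : ℕ) + 1)).re ≤ ‖a‖ * F := by
    intro a
    have h1 : ∑ i : Fin N, (conj (a i) * f ((i : ℕ) + 1)).re
        ≤ ∑ i : Fin N, ‖a i‖ * ‖f ((i : ℕ) + 1)‖ := by
      refine Finset.sum_le_sum fun i _ => (Complex.re_le_norm _).trans ?_
      rw [norm_mul, RCLike.norm_conj]
    refine h1.trans ((Real.sum_mul_le_sqrt_mul_sqrt _ _ _).trans ?_)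
    rw [← EuclideanSpace.norm_eq]
    gcongr
    rw [Real.sqrt_le_left hF.le]
    have hinj : Function.Injective (fun i : Fin N => (((i : ℕ) : ℤ) + 1)) := by
      intro i j hij; simpa [Fin.ext_iff] using hij
    have := hfF (Finset.univ.map ⟨fun i : Fin N => (((i : ℕ) : ℤ) + 1), hinj⟩)
    simpa using this
  -- Twice the natural radius `F / γ` makes the pairing strictly positive on the sphere; the lost
  -- factor is harmless, since the sharp bound is proved separately.
  obtain ⟨a, haR, ha⟩ := exists_zero_of_inner_pos hP (R := 2 * F / γ) (by positivity) (by
    intro a ha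
    rw [hinner a]
    have h1 := hforce a
    have h2 : γ * ‖a‖ = 2 * F := by rw [ha]; field_simp
    have h3 : 0 < ‖a‖ := by rw [ha]; positivity
    have h4 : γ * ‖a‖ ^ 2 = 2 * F * ‖a‖ := by rw [← h2]; ring
    nlinarith [mul_pos h3 hF])
  have hpos : ∀ i : Fin N, I * κ * ((i : ℕ) + 1) / 2 * conv (symExtend a) (symExtend a) ((i : ℕ) + 1)
      + ((I * κ * ((i : ℕ) + 1)) ^ 3 + γ) * a i = f ((i : ℕ) + 1) := by
    intro i
    have : p a i = 0 := by
      change P a i = 0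
      rw [ha]; rfl
    exact sub_eq_zero.1 this
  refine ⟨symExtend a, symExtend_neg a, symExtend_zero a, symExtend_of_lt a, ?_, ?_⟩
  · rw [sum_norm_sq_symExtend]
    gcongr
  · have hposk : ∀ m : ℕ, m < N → I * κ * ((m : ℤ) + 1 : ℤ) / 2 *
        conv (symExtend a) (symExtend a) ((m : ℤ) + 1)
      + ((I * κ * ((m : ℤ) + 1 : ℤ)) ^ 3 + γ) * symExtend a ((m : ℤ) + 1) = f ((m : ℤ) + 1) := by
      intro m hm
      have := hpos ⟨m, hm⟩
      rw [← symExtend_add_one a] at this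
      push_cast
      exact this
    intro k hk
    match k with
    | Int.ofNat 0 => simp [symExtend_zero, hf0]
    | Int.ofNat (m + 1) =>
      refine hposk m ?_
      rw [Int.ofNat_eq_natCast, abs_of_nonneg (by positivity)] at hk; omega
    | Int.negSucc m =>
      rw [Int.negSucc_eq] at hk ⊢
      rw [abs_neg, abs_of_nonneg (by positivity)] at hk
      -- Negative modes satisfy the conjugates of the equations for positive modes.
      have h := congrArg conj (hposk m (by omega))
      rw [← hf, map_add, map_mul, map_mul, ← conv_neg (symExtend_neg a) (symExtend_neg a),
        ← symExtend_neg] at h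
      rw [← h]
      congr 2
      · simp only [map_mul, map_div₀, conj_I, conj_ofReal, map_intCast, map_ofNat]
        push_cast; ring
      · simp only [map_mul, map_add, map_pow, conj_I, conj_ofReal, map_intCast]
        push_cast; ring

end Galerkin

/-! ### Uniform decay, passage to the limit and bootstrapping. -/

section FourierSolution

open Complex ComplexConjugate Filter Topology

theorem norm_mul_le_half_add_sq (z w : ℂ) : ‖z * w‖ ≤ (‖z‖ ^ 2 + ‖w‖ ^ 2) / 2 := by
  rw [norm_mul]; nlinarith [sq_nonneg (‖z‖ - ‖w‖)]

theorem norm_conv_self_le {c : ℤ → ℂ} {M : ℝ} (hc : HasSum (fun k => ‖c k‖ ^ 2) M) (k : ℤ) :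
    ‖conv c c k‖ ≤ M := by
  have h2 : HasSum (fun j => ‖c (k - j)‖ ^ 2) M :=
    (Equiv.subLeft k).hasSum_iff (f := fun j => ‖c j‖ ^ 2) |>.2 hc
  have h3 : HasSum (fun j => (‖c j‖ ^ 2 + ‖c (k - j)‖ ^ 2) / 2) M := by
    simpa using (hc.add h2).div_const 2
  exact tsum_of_norm_bounded h3 fun j => norm_mul_le_half_add_sq _ _

theorem summable_const_div_int_pow (C : ℝ) {p : ℕ} (hp : 1 < p) :
    Summable fun k : ℤ => C / |(k : ℝ)| ^ p := by
  have h := ((Real.summable_one_div_int_pow (p := p)).2 hp).abs.mul_left C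
  refine h.congr fun k => ?_
  rw [abs_div, abs_one, abs_pow, mul_one_div]

theorem norm_le_div_of_pow_mul_le {c : ℤ → ℂ} (h0 : c 0 = 0) {C : ℝ} {p : ℕ}
    (hC : ∀ k : ℤ, |(k : ℝ)| ^ p * ‖c k‖ ≤ C) (k : ℤ) : ‖c k‖ ≤ C / |(k : ℝ)| ^ p := by
  rcases eq_or_ne k 0 with rfl | hk
  · rw [h0, norm_zero]
    have := (by positivity : (0 : ℝ) ≤ |((0 : ℤ) : ℝ)| ^ p * ‖c 0‖).trans (hC 0)
    positivity
  · have : (0 : ℝ) < |(k : ℝ)| ^ p := by positivity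
    rw [le_div_iff₀ this, mul_comm]
    exact hC k

theorem summable_norm_of_pow_mul_le {c : ℤ → ℂ} (h0 : c 0 = 0) {C : ℝ} {p : ℕ} (hp : 1 < p)
    (hC : ∀ k : ℤ, |(k : ℝ)| ^ p * ‖c k‖ ≤ C) : Summable fun k => ‖c k‖ :=
  Summable.of_nonneg_of_le (fun _ => norm_nonneg _) (norm_le_div_of_pow_mul_le h0 hC)
    (summable_const_div_int_pow C hp)

theorem one_le_abs_intCast {k : ℤ} (hk : k ≠ 0) : (1 : ℝ) ≤ |(k : ℝ)| := by
  rw [← Int.cast_abs]; exact_mod_cast Int.one_le_abs hk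

/-- Polynomial decay of order `p ≥ 2` is inherited by the self-convolution. -/
theorem exists_pow_mul_norm_conv_le {c : ℤ → ℂ} (h0 : c 0 = 0) {C : ℝ} {p : ℕ} (hp : 1 < p)
    (hC : ∀ k : ℤ, |(k : ℝ)| ^ p * ‖c k‖ ≤ C) :
    ∃ C', ∀ k : ℤ, |(k : ℝ)| ^ p * ‖conv c c k‖ ≤ C' := by
  have hs := summable_norm_of_pow_mul_le h0 hp hC
  obtain ⟨S, hS⟩ := hs
  refine ⟨2 ^ (p - 1) * C * (S + S), fun k => ?_⟩
  have hS' : HasSum (fun j => ‖c (k - j)‖) S :=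
    (Equiv.subLeft k).hasSum_iff (f := fun j => ‖c j‖) |>.2 hS
  have hb := (hS'.add hS).mul_left (2 ^ (p - 1) * C)
  have hk : |(k : ℝ)| ^ p * ‖conv c c k‖ = ‖∑' j, ((|(k : ℝ)| ^ p : ℝ) : ℂ) * (c j * c (k - j))‖ := by
    rw [tsum_mul_left, norm_mul, Complex.norm_real, Real.norm_eq_abs,
      abs_of_nonneg (a := |(k : ℝ)| ^ p) (by positivity), conv]
  rw [hk]
  refine tsum_of_norm_bounded hb fun j => ?_
  rw [norm_mul, Complex.norm_real, Real.norm_eq_abs,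
    abs_of_nonneg (a := |(k : ℝ)| ^ p) (by positivity), norm_mul]
  have h1 : |(k : ℝ)| ^ p ≤ 2 ^ (p - 1) * (|(j : ℝ)| ^ p + |((k - j : ℤ) : ℝ)| ^ p) := by
    refine le_trans ?_ (add_pow_le (abs_nonneg _) (abs_nonneg _) p)
    refine pow_le_pow_left₀ (abs_nonneg _) ?_ p
    have := abs_add_le (j : ℝ) ((k - j : ℤ) : ℝ)
    simpa using this
  calc |(k : ℝ)| ^ p * (‖c j‖ * ‖c (k - j)‖)
      ≤ 2 ^ (p - 1) * (|(j : ℝ)| ^ p + |((k - j : ℤ) : ℝ)| ^ p) * (‖c j‖ * ‖c (k - j)‖) := by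
        gcongr
    _ = 2 ^ (p - 1) * ((|(j : ℝ)| ^ p * ‖c j‖) * ‖c (k - j)‖
          + (|((k - j : ℤ) : ℝ)| ^ p * ‖c (k - j)‖) * ‖c j‖) := by ring
    _ ≤ 2 ^ (p - 1) * (C * ‖c (k - j)‖ + C * ‖c j‖) := by
        gcongr
        · exact hC j
        · exact hC (k - j)
    _ = 2 ^ (p - 1) * C * (‖c (k - j)‖ + ‖c j‖) := by ring

/-- The imaginary part of the symbol `(iκk)³ + γ` has modulus `(κ|k|)³`, so dispersion gains three
powers of `k` whatever the damping, against one lost in the convective term. -/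
theorem dispersive_bound {κ γ : ℝ} (hκ : 0 < κ) {c f : ℤ → ℂ} {k : ℤ}
    (h : I * κ * k / 2 * conv c c k + ((I * κ * k) ^ 3 + γ) * c k = f k) :
    (κ * |(k : ℝ)|) ^ 3 * ‖c k‖ ≤ ‖f k‖ + κ * |(k : ℝ)| / 2 * ‖conv c c k‖ := by
  have h1 : (κ * |(k : ℝ)|) ^ 3 ≤ ‖((I * κ * k) ^ 3 + γ : ℂ)‖ := by
    have e : ((I * κ * k) ^ 3 + γ : ℂ) = (γ : ℂ) + ((-(κ * k) ^ 3 : ℝ) : ℂ) * I := by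
      push_cast
      rw [mul_assoc, mul_pow, pow_succ I 2, I_sq]; ring
    have h2 := Complex.abs_im_le_norm ((I * κ * k) ^ 3 + γ : ℂ)
    rw [e] at h2 ⊢
    refine le_trans (le_of_eq ?_) h2
    rw [Complex.add_im, Complex.ofReal_im, Complex.im_ofReal_mul, I_im, zero_add, mul_one, abs_neg,
      abs_pow, abs_mul, abs_of_pos hκ]
  have h2 : ‖(I * κ * k / 2 : ℂ)‖ = κ * |(k : ℝ)| / 2 := by
    rw [norm_div, norm_mul, norm_mul, norm_I, Complex.norm_real, Complex.norm_intCast,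
      Real.norm_eq_abs, abs_of_pos hκ, one_mul]
    norm_num
  calc (κ * |(k : ℝ)|) ^ 3 * ‖c k‖ ≤ ‖((I * κ * k) ^ 3 + γ : ℂ)‖ * ‖c k‖ := by gcongr
    _ = ‖f k - I * κ * k / 2 * conv c c k‖ := by rw [← norm_mul, ← h]; congr 1; ring
    _ ≤ ‖f k‖ + ‖I * κ * k / 2 * conv c c k‖ := norm_sub_le _ _
    _ = _ := by rw [norm_mul, h2]

theorem exists_fourier_solution {κ γ A : ℝ} (hκ : 0 < κ) (hγ : 0 < γ) {f : ℤ → ℂ}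
    (hf0 : f 0 = 0) (hf : ∀ k, f (-k) = conj (f k))
    (hA : ∀ k : ℤ, |(k : ℝ)| ^ 2 * ‖f k‖ ≤ A) :
    ∃ c : ℤ → ℂ, (∀ k, c (-k) = conj (c k)) ∧ c 0 = 0 ∧
      (∃ C, ∀ k : ℤ, |(k : ℝ)| ^ 5 * ‖c k‖ ≤ C) ∧
      ∀ k, I * κ * k / 2 * conv c c k + ((I * κ * k) ^ 3 + γ) * c k = f k := by
  have hA0 : 0 ≤ A := by simpa using hA 0
  have hfA : ∀ k, ‖f k‖ ≤ A := by
    intro k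
    rcases eq_or_ne k 0 with rfl | hk
    · simpa [hf0] using hA0
    · refine le_trans ?_ (hA k)
      exact le_mul_of_one_le_left (norm_nonneg _) (one_le_pow₀ (one_le_abs_intCast hk))
  have hsf : Summable fun k => ‖f k‖ ^ 2 := by
    refine Summable.of_nonneg_of_le (fun _ => by positivity) (fun k => ?_)
      ((summable_norm_of_pow_mul_le hf0 one_lt_two hA).mul_left A)
    rw [sq]
    exact mul_le_mul_of_nonneg_right (hfA k) (norm_nonneg _)
  -- Adding `1` makes `F` positive and ensures `F ≤ F ^ 2`, so no square root is needed.
  set F : ℝ := 1 + ∑' k, ‖f k‖ ^ 2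
  have hts : 0 ≤ ∑' k, ‖f k‖ ^ 2 := tsum_nonneg fun k => by positivity
  have hF : 0 < F := by positivity
  have hfF : ∀ s : Finset ℤ, ∑ k ∈ s, ‖f k‖ ^ 2 ≤ F ^ 2 := by
    intro s
    have := hsf.sum_le_tsum s fun k _ => by positivity
    nlinarith
  choose a hsym ha0 hasupp haM heq using fun N => exists_truncated_solution (κ := κ) hγ hF hf0 hf hfF N
  set M : ℝ := 2 * (2 * F / γ) ^ 2
  have hM : 0 ≤ M := by positivity
  have hsq : ∀ N k, ‖conv (a N) (a N) k‖ ≤ M := by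
    intro N k
    have hs : HasSum (fun k => ‖a N k‖ ^ 2) (∑ k ∈ Finset.Icc (-(N : ℤ)) N, ‖a N k‖ ^ 2) := by
      refine hasSum_sum_of_ne_finset_zero fun k hk => ?_
      rw [hasupp N k, norm_zero, zero_pow two_ne_zero]
      by_contra h
      exact hk (Finset.mem_Icc.2 (abs_le.1 (not_lt.1 h)))
    exact (norm_conv_self_le hs k).trans (haM N)
  set C : ℝ := (A + κ / 2 * M) / κ ^ 3
  have hC0 : 0 ≤ C := by positivity
  have hdec : ∀ N, ∀ k : ℤ, |(k : ℝ)| ^ 2 * ‖a N k‖ ≤ C := by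
    intro N k
    rcases eq_or_ne k 0 with rfl | hk
    · simpa using hC0
    by_cases hkN : |k| ≤ (N : ℤ)
    · have h1 := dispersive_bound hκ (heq N k hkN)
      have h2 := one_le_abs_intCast hk
      set x := |(k : ℝ)|
      have h3 : κ ^ 3 * x * (x ^ 2 * ‖a N k‖) ≤ (A + κ / 2 * M) * x := by
        calc κ ^ 3 * x * (x ^ 2 * ‖a N k‖) = (κ * x) ^ 3 * ‖a N k‖ := by ring
          _ ≤ A + κ * x / 2 * M := h1.trans (by
              gcongr
              · exact hfA k
              · exact hsq N k)
          _ ≤ A * x + κ * x / 2 * M := by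
              gcongr
              exact le_mul_of_one_le_right hA0 h2
          _ = (A + κ / 2 * M) * x := by ring
      rw [le_div_iff₀ (by positivity)]
      refine le_of_mul_le_mul_right ?_ (lt_of_lt_of_le one_pos h2)
      linarith
    · rw [hasupp N k (not_le.1 hkN), norm_zero, mul_zero]
      exact hC0
  have hball : ∀ N, a N ∈ Set.pi Set.univ (fun k : ℤ => Metric.closedBall (0 : ℂ) (C / |(k : ℝ)| ^ 2)) := by
    intro N k _
    rw [mem_closedBall_zero_iff]
    exact norm_le_div_of_pow_mul_le (ha0 N) (hdec N) k
  -- By Tychonoff the product of the balls is compact, and a countable product is metrizable, so a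
  -- subsequence converges in every mode. The same radii are summable and dominate the convolutions.
  obtain ⟨c, -, φ, hφ, hlim⟩ := (isCompact_univ_pi fun k : ℤ =>
    isCompact_closedBall (0 : ℂ) (C / |(k : ℝ)| ^ 2)).tendsto_subseq hball
  have hlimk : ∀ k, Tendsto (fun n => a (φ n) k) atTop (𝓝 (c k)) := tendsto_pi_nhds.1 hlim
  have hc0 : c 0 = 0 := tendsto_nhds_unique (hlimk 0) (by simp only [ha0]; exact tendsto_const_nhds)
  have hcsym : ∀ k, c (-k) = conj (c k) := by
    intro k
    refine tendsto_nhds_unique (hlimk (-k)) ?_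
    simp only [hsym]
    exact (Complex.continuous_conj.tendsto _).comp (hlimk k)
  have hcdec : ∀ k : ℤ, |(k : ℝ)| ^ 2 * ‖c k‖ ≤ C := by
    intro k
    refine le_of_tendsto ((hlimk k).norm.const_mul _) (Eventually.of_forall fun n => hdec (φ n) k)
  have hle : ∀ N k, ‖a N k‖ ≤ C := by
    intro N k
    rcases eq_or_ne k 0 with rfl | hk
    · simpa [ha0 N] using hC0
    · refine le_trans ?_ (hdec N k)
      exact le_mul_of_one_le_left (norm_nonneg _) (one_le_pow₀ (one_le_abs_intCast hk))
  have hconv : ∀ k, Tendsto (fun n => conv (a (φ n)) (a (φ n)) k) atTop (𝓝 (conv c c k)) := by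
    intro k
    change Tendsto (fun n => ∑' j, a (φ n) j * a (φ n) (k - j)) atTop (𝓝 (∑' j, c j * c (k - j)))
    refine tendsto_tsum_of_dominated_convergence
      ((summable_const_div_int_pow C one_lt_two).mul_right C)
      (fun j => (hlimk j).mul (hlimk (k - j))) (Eventually.of_forall fun n j => ?_)
    rw [norm_mul]
    have h1 := norm_le_div_of_pow_mul_le (ha0 (φ n)) (hdec (φ n)) j
    exact mul_le_mul h1 (hle _ _) (norm_nonneg _) ((norm_nonneg _).trans h1)
  have hceq : ∀ k, I * κ * k / 2 * conv c c k + ((I * κ * k) ^ 3 + γ) * c k = f k := by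
    intro k
    have h1 : Tendsto (fun n => I * κ * k / 2 * conv (a (φ n)) (a (φ n)) k
        + ((I * κ * k) ^ 3 + γ) * a (φ n) k) atTop
        (𝓝 (I * κ * k / 2 * conv c c k + ((I * κ * k) ^ 3 + γ) * c k)) :=
      ((hconv k).const_mul _).add ((hlimk k).const_mul _)
    refine tendsto_nhds_unique h1 (tendsto_const_nhds.congr' ?_)
    filter_upwards [eventually_ge_atTop (|k|).toNat] with n hn
    refine (heq (φ n) k ?_).symm
    have := hφ.id_le n
    simp only [id] at this
    omega
  refine ⟨c, hcsym, hc0, ?_, hceq⟩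
  -- Decay of order `p` of `c * c` yields order `p + 2` for `c`, capped at `5` by the decay `k⁻²` of
  -- the forcing. Two rounds lead from `2` through `4` to `5`.
  obtain ⟨B, hB⟩ := exists_pow_mul_norm_conv_le hc0 one_lt_two hcdec
  have hdec4 : ∀ k : ℤ, |(k : ℝ)| ^ 4 * ‖c k‖ ≤ (A + κ / 2 * B) / κ ^ 3 := by
    intro k
    have hB0 : 0 ≤ B := le_trans (by positivity) (hB 0)
    rcases eq_or_ne k 0 with rfl | hk
    · simp only [Int.cast_zero, abs_zero, ne_eq, OfNat.ofNat_ne_zero, not_false_eq_true, zero_pow,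
        zero_mul]
      positivity
    have h1 := dispersive_bound hκ (hceq k)
    have h2 := one_le_abs_intCast hk
    have h4 := hA k
    have h5 := hB k
    set x := |(k : ℝ)|
    rw [le_div_iff₀ (by positivity)]
    calc x ^ 4 * ‖c k‖ * κ ^ 3 = x * ((κ * x) ^ 3 * ‖c k‖) := by ring
      _ ≤ x * (‖f k‖ + κ * x / 2 * ‖conv c c k‖) := by gcongr
      _ = x * ‖f k‖ + κ / 2 * (x ^ 2 * ‖conv c c k‖) := by ring
      _ ≤ x ^ 2 * ‖f k‖ + κ / 2 * (x ^ 2 * ‖conv c c k‖) := by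
        gcongr
        exact le_self_pow₀ h2 two_ne_zero
      _ ≤ _ := by gcongr
  obtain ⟨B', hB'⟩ := exists_pow_mul_norm_conv_le hc0 (by norm_num) hdec4
  refine ⟨(A + κ / 2 * B') / κ ^ 3, fun k => ?_⟩
  have hB0 : 0 ≤ B' := le_trans (by positivity) (hB' 0)
  rcases eq_or_ne k 0 with rfl | hk
  · simp only [Int.cast_zero, abs_zero, ne_eq, OfNat.ofNat_ne_zero, not_false_eq_true, zero_pow,
      zero_mul]
    positivity
  have h1 := dispersive_bound hκ (hceq k)
  have h2 := one_le_abs_intCast hk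
  have h4 := hA k
  have h5 := hB' k
  have h6 : |(k : ℝ)| ^ 3 ≤ |(k : ℝ)| ^ 4 := pow_le_pow_right₀ h2 (by norm_num)
  set x := |(k : ℝ)|
  rw [le_div_iff₀ (by positivity)]
  calc x ^ 5 * ‖c k‖ * κ ^ 3 = x ^ 2 * ((κ * x) ^ 3 * ‖c k‖) := by ring
    _ ≤ x ^ 2 * (‖f k‖ + κ * x / 2 * ‖conv c c k‖) := by gcongr
    _ = x ^ 2 * ‖f k‖ + κ / 2 * (x ^ 3 * ‖conv c c k‖) := by ring
    _ ≤ x ^ 2 * ‖f k‖ + κ / 2 * (x ^ 4 * ‖conv c c k‖) := by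
      gcongr
    _ ≤ _ := by gcongr

end FourierSolution

/-! ### Trigonometric series and the classical solution they sum to. -/

section TrigSum

open Complex ComplexConjugate Filter Topology

/-- The trigonometric series with coefficients `c` and fundamental frequency `κ`. -/
noncomputable def trigSum (κ : ℝ) (c : ℤ → ℂ) (x : ℝ) : ℂ := ∑' k : ℤ, c k * cexp (I * κ * k * x)

/-- The coefficients of the formal derivative of `trigSum κ c`. -/
noncomputable def derivCoeff (κ : ℝ) (c : ℤ → ℂ) (k : ℤ) : ℂ := I * κ * k * c k

theorem norm_cexp_mode (κ : ℝ) (k : ℤ) (x : ℝ) : ‖cexp (I * κ * k * x)‖ = 1 := by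
  have : (I * κ * k * x : ℂ) = ((κ * k * x : ℝ) : ℂ) * I := by push_cast; ring
  rw [this, Complex.norm_exp_ofReal_mul_I]

theorem norm_mul_cexp_mode (κ : ℝ) (z : ℂ) (k : ℤ) (x : ℝ) :
    ‖z * cexp (I * κ * k * x)‖ = ‖z‖ := by
  rw [norm_mul, norm_cexp_mode, mul_one]

theorem summable_trigSum {c : ℤ → ℂ} (hc : Summable fun k => ‖c k‖) (κ x : ℝ) :
    Summable fun k : ℤ => c k * cexp (I * κ * k * x) :=
  Summable.of_norm (hc.congr fun k => (norm_mul_cexp_mode κ _ k x).symm)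

theorem hasDerivAt_cexp_mode (κ : ℝ) (k : ℤ) (x : ℝ) :
    HasDerivAt (fun y : ℝ => cexp (I * κ * k * y)) (I * κ * k * cexp (I * κ * k * x)) x := by
  have h1 : HasDerivAt (fun y : ℝ => (I * κ * k * y : ℂ)) (I * κ * k * 1) x :=
    (Complex.ofRealCLM.hasDerivAt (x := x)).const_mul (I * κ * k : ℂ)
  have h2 := h1.cexp
  rwa [mul_one, mul_comm (cexp _)] at h2

theorem hasDerivAt_trigSum {κ : ℝ} {c : ℤ → ℂ} (hc : Summable fun k => ‖c k‖)
    (hd : Summable fun k => ‖derivCoeff κ c k‖) (x : ℝ) :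
    HasDerivAt (trigSum κ c) (trigSum κ (derivCoeff κ c) x) x := by
  refine hasDerivAt_tsum hd (g := fun k (y : ℝ) => c k * cexp (I * κ * k * y))
    (g' := fun k (y : ℝ) => derivCoeff κ c k * cexp (I * κ * k * y)) (fun k y => ?_) (fun k y => ?_)
    (summable_trigSum hc κ x) x
  · have h := (hasDerivAt_cexp_mode κ k y).const_mul (c k)
    have e : derivCoeff κ c k * cexp (I * κ * k * y)
        = c k * (I * κ * k * cexp (I * κ * k * y)) := by
      rw [derivCoeff]; ring
    exact e ▸ h
  · exact (norm_mul_cexp_mode κ _ k y).le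

theorem continuous_trigSum {κ : ℝ} {c : ℤ → ℂ} (hc : Summable fun k => ‖c k‖) :
    Continuous (trigSum κ c) :=
  continuous_tsum (fun k => by fun_prop) hc fun k x => (norm_mul_cexp_mode κ _ k x).le

theorem periodic_trigSum {κ : ℝ} (hκ : κ ≠ 0) (c : ℤ → ℂ) :
    Function.Periodic (trigSum κ c) (2 * Real.pi / κ) := by
  intro x
  refine tsum_congr fun k => ?_
  have : (I * κ * k * ((x + 2 * Real.pi / κ : ℝ) : ℂ)) = I * κ * k * x + k * (2 * Real.pi * I) := by
    have : (κ : ℂ) ≠ 0 := by exact_mod_cast hκ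
    push_cast
    field_simp
  rw [this, Complex.exp_add, Complex.exp_int_mul_two_pi_mul_I, mul_one]

theorem trigSum_conj {κ : ℝ} {c : ℤ → ℂ} (hc : ∀ k, c (-k) = conj (c k)) (x : ℝ) :
    conj (trigSum κ c x) = trigSum κ c x := by
  unfold trigSum
  rw [conj_tsum, ← (Equiv.neg ℤ).tsum_eq]
  refine tsum_congr fun k => ?_
  rw [Equiv.neg_apply, map_mul, hc, conj_conj, ← Complex.exp_conj]
  congr 2
  simp

theorem ofReal_re_trigSum {κ : ℝ} {c : ℤ → ℂ} (hc : ∀ k, c (-k) = conj (c k)) (x : ℝ) :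
    (((trigSum κ c x).re : ℝ) : ℂ) = trigSum κ c x :=
  Complex.conj_eq_iff_re.1 (trigSum_conj hc x)

theorem derivCoeff_neg {κ : ℝ} {c : ℤ → ℂ} (hc : ∀ k, c (-k) = conj (c k)) (k : ℤ) :
    derivCoeff κ c (-k) = conj (derivCoeff κ c k) := by
  simp [derivCoeff, hc]

theorem derivCoeff_zero (κ : ℝ) (c : ℤ → ℂ) : derivCoeff κ c 0 = 0 := by simp [derivCoeff]

theorem norm_derivCoeff {κ : ℝ} (hκ : 0 < κ) (c : ℤ → ℂ) (k : ℤ) :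
    ‖derivCoeff κ c k‖ = κ * |(k : ℝ)| * ‖c k‖ := by
  rw [derivCoeff, norm_mul, norm_mul, norm_mul, norm_I, Complex.norm_real, Complex.norm_intCast,
    Real.norm_eq_abs, abs_of_pos hκ, one_mul]

theorem pow_mul_norm_derivCoeff_le {κ : ℝ} (hκ : 0 < κ) {c : ℤ → ℂ} {p : ℕ} {C : ℝ}
    (hC : ∀ k : ℤ, |(k : ℝ)| ^ (p + 1) * ‖c k‖ ≤ C) (k : ℤ) :
    |(k : ℝ)| ^ p * ‖derivCoeff κ c k‖ ≤ κ * C := by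
  rw [norm_derivCoeff hκ]
  calc |(k : ℝ)| ^ p * (κ * |(k : ℝ)| * ‖c k‖) = κ * (|(k : ℝ)| ^ (p + 1) * ‖c k‖) := by ring
    _ ≤ κ * C := by gcongr; exact hC k

theorem trigSum_mul {κ : ℝ} {c d : ℤ → ℂ} (hc : Summable fun k => ‖c k‖)
    (hd : Summable fun k => ‖d k‖) (x : ℝ) :
    trigSum κ c x * trigSum κ d x = trigSum κ (conv c d) x := by
  have hc' : Summable fun k : ℤ => ‖c k * cexp (I * κ * k * x)‖ :=
    hc.congr fun k => (norm_mul_cexp_mode κ _ k x).symm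
  have hd' : Summable fun k : ℤ => ‖d k * cexp (I * κ * k * x)‖ :=
    hd.congr fun k => (norm_mul_cexp_mode κ _ k x).symm
  -- Reindexes the double series by total frequency `k` and first frequency `j`.
  let e : ℤ × ℤ ≃ ℤ × ℤ :=
    { toFun := fun z => (z.2, z.1 - z.2)
      invFun := fun z => (z.1 + z.2, z.1)
      left_inv := fun z => by ext <;> simp
      right_inv := fun z => by ext <;> simp }
  have hs := summable_mul_of_summable_norm hc' hd'
  have hse := e.summable_iff.2 hs
  unfold trigSum
  rw [tsum_mul_tsum_of_summable_norm hc' hd', ← e.tsum_eq]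
  refine (Summable.tsum_prod hse).trans (tsum_congr fun k => ?_)
  rw [conv, ← tsum_mul_right]
  refine tsum_congr fun j => ?_
  change c j * cexp (I * κ * j * x) * (d (k - j) * cexp (I * κ * (k - j : ℤ) * x)) = _
  rw [show I * κ * k * x = I * κ * j * x + I * κ * (k - j : ℤ) * x by push_cast; ring,
    Complex.exp_add]
  ring

theorem HasDerivAt.complex_re {g : ℝ → ℂ} {g' : ℂ} {x : ℝ} (h : HasDerivAt g g' x) :
    HasDerivAt (fun y => (g y).re) g'.re x :=
  Complex.reCLM.hasFDerivAt.comp_hasDerivAt x h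

theorem exists_classical_solution {κ γ A : ℝ} (hκ : 0 < κ) (hγ : 0 < γ) {f : ℤ → ℂ}
    (hf0 : f 0 = 0) (hf : ∀ k, f (-k) = conj (f k))
    (hA : ∀ k : ℤ, |(k : ℝ)| ^ 2 * ‖f k‖ ≤ A) :
    ∃ u u₁ u₂ u₃ : ℝ → ℝ, Function.Periodic u (2 * Real.pi / κ) ∧
      (∀ x, HasDerivAt u (u₁ x) x) ∧ (∀ x, HasDerivAt u₁ (u₂ x) x) ∧
      (∀ x, HasDerivAt u₂ (u₃ x) x) ∧ Continuous u₃ ∧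
      ∀ x, u x * u₁ x + u₃ x + γ * u x = (trigSum κ f x).re := by
  obtain ⟨c, hsym, hc0, ⟨C, hC⟩, heq⟩ := exists_fourier_solution hκ hγ hf0 hf hA
  obtain ⟨B, hB⟩ := exists_pow_mul_norm_conv_le hc0 (by norm_num) hC
  have hC1 := pow_mul_norm_derivCoeff_le (p := 4) hκ hC
  have hC2 := pow_mul_norm_derivCoeff_le (p := 3) hκ hC1
  have hC3 := pow_mul_norm_derivCoeff_le (p := 2) hκ hC2
  have hs0 := summable_norm_of_pow_mul_le hc0 (by norm_num) hC
  have hs1 := summable_norm_of_pow_mul_le (derivCoeff_zero _ _) (by norm_num) hC1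
  have hs2 := summable_norm_of_pow_mul_le (derivCoeff_zero _ _) (by norm_num) hC2
  have hs3 := summable_norm_of_pow_mul_le (derivCoeff_zero _ _) (by norm_num) hC3
  have hB1 := pow_mul_norm_derivCoeff_le (p := 4) hκ hB
  have hsB1 := summable_norm_of_pow_mul_le (derivCoeff_zero _ _) (by norm_num) hB1
  have hsB : Summable fun k => ‖conv c c k‖ := by
    refine Summable.of_nonneg_of_le (fun _ => norm_nonneg _) (fun k => ?_)
      -- The zero mode of `c * c` need not vanish, while the majorant `B / 0` is `0` there, so this
      -- one value is replaced.
      ((summable_const_div_int_pow B (p := 5) (by norm_num)).update 0 ‖conv c c 0‖)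
    rcases eq_or_ne k 0 with rfl | hk
    · simp
    · rw [Function.update_of_ne hk, le_div_iff₀ (by positivity), mul_comm]
      exact hB k
  set c1 := derivCoeff κ c
  set c2 := derivCoeff κ c1
  set c3 := derivCoeff κ c2
  have hsym1 := derivCoeff_neg (κ := κ) hsym
  have hsym2 := derivCoeff_neg (κ := κ) hsym1
  have hsym3 := derivCoeff_neg (κ := κ) hsym2
  have hd0 := fun x => hasDerivAt_trigSum (κ := κ) hs0 hs1 x
  have hd1 := fun x => hasDerivAt_trigSum (κ := κ) hs1 hs2 x
  have hd2 := fun x => hasDerivAt_trigSum (κ := κ) hs2 hs3 x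
  -- Both sides are the derivative of the square of the series, computed termwise and by the product
  -- rule.
  have hprod : ∀ x, trigSum κ (derivCoeff κ (conv c c)) x = 2 * (trigSum κ c x * trigSum κ c1 x) := by
    intro x
    have h1 := hasDerivAt_trigSum (κ := κ) hsB hsB1 x
    have h2 := (hd0 x).mul (hd0 x)
    have h3 : trigSum κ c * trigSum κ c = trigSum κ (conv c c) :=
      funext fun y => trigSum_mul hs0 hs0 y
    rw [h3] at h2
    rw [h1.unique h2]
    ring
  have hsum : ∀ x, trigSum κ c x * trigSum κ c1 x + trigSum κ c3 x + γ * trigSum κ c x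
      = trigSum κ f x := by
    intro x
    have h1 := ((((summable_trigSum hsB1 κ x).hasSum.mul_left (1 / 2)).add
      (summable_trigSum hs3 κ x).hasSum).add ((summable_trigSum hs0 κ x).hasSum.mul_left (γ : ℂ)))
    have h2 := h1.tsum_eq
    have h3 : trigSum κ f x = 1 / 2 * trigSum κ (derivCoeff κ (conv c c)) x + trigSum κ c3 x
        + γ * trigSum κ c x := by
      refine Eq.trans (tsum_congr fun k => ?_) h2
      rw [← heq k]
      simp only [c3, c2, c1, derivCoeff]
      ring
    rw [h3, hprod]
    ring
  refine ⟨fun x => (trigSum κ c x).re, fun x => (trigSum κ c1 x).re, fun x => (trigSum κ c2 x).re,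
    fun x => (trigSum κ c3 x).re, ?_, fun x => (hd0 x).complex_re, fun x => (hd1 x).complex_re,
    fun x => (hd2 x).complex_re, Complex.continuous_re.comp (continuous_trigSum hs3), ?_⟩
  · intro x
    simp only [periodic_trigSum hκ.ne' c x]
  · intro x
    rw [← hsum x, ← ofReal_re_trigSum hsym x, ← ofReal_re_trigSum hsym1 x,
      ← ofReal_re_trigSum hsym3 x]
    norm_cast

end TrigSum

/-! ### Fourier series of the forcing and its `C¹` representative. -/

section Forcing

open Complex ComplexConjugate Filter Topology PeriodicKdV

/-- The Fourier coefficients of an `L`-periodic function. -/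
noncomputable def fourierCoef (L : ℝ) (f : ℝ → ℂ) (k : ℤ) : ℂ :=
  (1 / L : ℂ) * ∫ x in (0 : ℝ)..L, f x * cexp (-(I * (2 * Real.pi / L : ℝ) * k * x))

theorem fourierCoef_eq_fourierCoeffOn {L : ℝ} (hL : 0 < L) (f : ℝ → ℂ) (k : ℤ) :
    fourierCoeffOn hL f k = fourierCoef L f k := by
  rw [fourierCoeffOn_eq_integral, fourierCoef, sub_zero, Complex.real_smul]
  congr 1
  · push_cast; rfl
  · refine intervalIntegral.integral_congr fun x _ => ?_
    change fourier (-k) (x : AddCircle L) • f x = _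
    rw [smul_eq_mul, fourier_coe_apply, mul_comm]
    congr 2
    push_cast
    ring

theorem hasSum_sq_fourierCoef {L : ℝ} (hL : 0 < L) {f : ℝ → ℂ}
    (hf : MemLp f 2 (volume.restrict (Set.Ioc 0 L))) :
    HasSum (fun k => ‖fourierCoef L f k‖ ^ 2) (L⁻¹ * ∫ x in (0 : ℝ)..L, ‖f x‖ ^ 2) := by
  have h := hasSum_sq_fourierCoeffOn hL hf
  simpa only [fourierCoef_eq_fourierCoeffOn, sub_zero, smul_eq_mul] using h

theorem intervalIntegrable_of_memLp_two {L : ℝ} (hL : 0 < L) {f : ℝ → ℂ}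
    (hf : MemLp f 2 (volume.restrict (Set.Ioc 0 L))) : IntervalIntegrable f volume 0 L :=
  (intervalIntegrable_iff_integrableOn_Ioc_of_le hL.le).2 (hf.integrable one_le_two)

theorem IsL2.intervalIntegrable {L : ℝ} (hL : 0 < L) {f : ℝ → ℝ} (hf : IsL2 L f) :
    IntervalIntegrable f volume 0 L :=
  (intervalIntegrable_iff_integrableOn_Ioc_of_le hL.le).2 (MemLp.integrable one_le_two hf)

/-- Parseval gives vanishing almost everywhere on one period; the exceptional set is invariant under
the period, so it is null on the whole line. -/
theorem ae_eq_zero_of_fourierCoef_eq_zero {L : ℝ} (hL : 0 < L) {h : ℝ → ℂ}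
    (hper : Function.Periodic h L) (hm : MemLp h 2 (volume.restrict (Set.Ioc 0 L)))
    (h0 : ∀ k, fourierCoef L h k = 0) : h =ᵐ[volume] 0 := by
  have hs := hasSum_sq_fourierCoef hL hm
  simp only [h0, norm_zero, ne_eq, OfNat.ofNat_ne_zero, not_false_eq_true, zero_pow] at hs
  have h1 : ∫ x in Set.Ioc 0 L, ‖h x‖ ^ 2 = 0 := by
    have := hs.unique hasSum_zero
    rw [mul_eq_zero, inv_eq_zero] at this
    rw [← intervalIntegral.integral_of_le hL.le]
    exact this.resolve_left hL.ne'
  have h2 : h =ᵐ[volume.restrict (Set.Ioc 0 L)] 0 := by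
    have := (integral_eq_zero_iff_of_nonneg (fun x => by positivity) hm.integrable_norm_pow').1 h1
    filter_upwards [this] with x hx
    simpa using hx
  have hfd := isAddFundamentalDomain_Ioc hL 0 (volume : Measure ℝ)
  rw [zero_add] at hfd
  change volume {x | h x = 0}ᶜ = 0
  refine hfd.measure_zero_of_invariant _ (fun g => ?_) ?_
  · obtain ⟨_, n, rfl⟩ := g
    ext x
    rw [Set.mem_vadd_set_iff_neg_vadd_mem]
    change ¬ (h (-(n • L) + x) = 0) ↔ ¬ (h x = 0)
    rw [add_comm, ← sub_eq_add_neg, hper.sub_zsmul_eq]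
  · rw [← Measure.restrict_apply' measurableSet_Ioc]
    exact h2

theorem integral_cexp_mode {L : ℝ} (hL : 0 < L) (m : ℤ) :
    ∫ x in (0 : ℝ)..L, cexp (I * (2 * Real.pi / L : ℝ) * m * x) = if m = 0 then (L : ℂ) else 0 := by
  split_ifs with hm
  · subst hm; simp
  · have hL' : (L : ℂ) ≠ 0 := by exact_mod_cast hL.ne'
    have hpi : (Real.pi : ℂ) ≠ 0 := by exact_mod_cast Real.pi_ne_zero
    have hm' : (m : ℂ) ≠ 0 := by exact_mod_cast hm
    have hne : (I * (2 * Real.pi / L : ℝ) * m : ℂ) ≠ 0 := by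
      push_cast
      exact mul_ne_zero (mul_ne_zero I_ne_zero (div_ne_zero (mul_ne_zero two_ne_zero hpi) hL')) hm'
    rw [integral_exp_mul_complex hne]
    have : (I * (2 * Real.pi / L : ℝ) * m * L : ℂ) = m * (2 * Real.pi * I) := by
      push_cast; field_simp
    rw [this, Complex.exp_int_mul_two_pi_mul_I]
    simp

theorem fourierCoef_trigSum {L : ℝ} (hL : 0 < L) {c : ℤ → ℂ} (hc : Summable fun k => ‖c k‖)
    (k : ℤ) : fourierCoef L (trigSum (2 * Real.pi / L) c) k = c k := by
  have hterm : ∀ (j : ℤ) (x : ℝ), c j * cexp (I * (2 * Real.pi / L : ℝ) * j * x)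
      * cexp (-(I * (2 * Real.pi / L : ℝ) * k * x))
      = c j * cexp (I * (2 * Real.pi / L : ℝ) * (j - k : ℤ) * x) := by
    intro j x
    rw [mul_assoc, ← Complex.exp_add]
    congr 2
    push_cast; ring
  have h1 : HasSum (fun j : ℤ => ∫ x in (0 : ℝ)..L,
        c j * cexp (I * (2 * Real.pi / L : ℝ) * (j - k : ℤ) * x))
      (∫ x in (0 : ℝ)..L, trigSum (2 * Real.pi / L) c x
        * cexp (-(I * (2 * Real.pi / L : ℝ) * k * x))) := by
    refine intervalIntegral.hasSum_integral_of_dominated_convergence (fun j _ => ‖c j‖) ?_ ?_ ?_ ?_ ?_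
    · intro j
      exact Continuous.aestronglyMeasurable (by fun_prop)
    · exact fun j => Eventually.of_forall fun x _ => (norm_mul_cexp_mode _ _ _ x).le
    · exact Eventually.of_forall fun x _ => hc
    · exact intervalIntegrable_const
    · refine Eventually.of_forall fun x _ => ?_
      have := (summable_trigSum hc (2 * Real.pi / L) x).hasSum.mul_right
        (cexp (-(I * (2 * Real.pi / L : ℝ) * k * x)))
      simp only [hterm] at this
      exact this
  have h2 : ∀ j : ℤ, ∫ x in (0 : ℝ)..L, c j * cexp (I * (2 * Real.pi / L : ℝ) * (j - k : ℤ) * x)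
      = if j = k then c k * L else 0 := by
    intro j
    rw [intervalIntegral.integral_const_mul, integral_cexp_mode hL]
    by_cases h : j = k
    · simp [h]
    · simp [h, sub_eq_zero]
  simp only [h2] at h1
  have h3 := h1.unique (hasSum_ite_eq k (c k * L))
  rw [fourierCoef, h3]
  have hL' : (L : ℂ) ≠ 0 := by exact_mod_cast hL.ne'
  field_simp

theorem fourierCoef_ofReal {L : ℝ} (hL : 0 < L) {f : ℝ → ℝ} (hf : IsL2 L f) (k : ℤ) :
    fourierCoef L (fun x => (f x : ℂ)) k
      = (1 / L : ℂ) * ((∫ x in (0 : ℝ)..L, f x * Real.cos (2 * Real.pi / L * k * x) : ℝ)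
        - I * (∫ x in (0 : ℝ)..L, f x * Real.sin (2 * Real.pi / L * k * x) : ℝ)) := by
  have hfi := IsL2.intervalIntegrable hL hf
  have h1 : IntervalIntegrable (fun x => f x * Real.cos (2 * Real.pi / L * k * x)) volume 0 L :=
    hfi.mul_continuousOn (by fun_prop)
  have h2 : IntervalIntegrable (fun x => f x * Real.sin (2 * Real.pi / L * k * x)) volume 0 L :=
    hfi.mul_continuousOn (by fun_prop)
  have h1' : IntervalIntegrable (fun x => ((f x * Real.cos (2 * Real.pi / L * k * x) : ℝ) : ℂ))
      volume 0 L := ⟨h1.1.ofReal, h1.2.ofReal⟩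
  have h2' : IntervalIntegrable (fun x => ((f x * Real.sin (2 * Real.pi / L * k * x) : ℝ) : ℂ))
      volume 0 L := ⟨h2.1.ofReal, h2.2.ofReal⟩
  rw [fourierCoef, ← intervalIntegral.integral_ofReal, ← intervalIntegral.integral_ofReal,
    ← intervalIntegral.integral_const_mul I, ← intervalIntegral.integral_sub h1' (h2'.const_mul I)]
  congr 1
  refine intervalIntegral.integral_congr fun x _ => ?_
  have : (-(I * (2 * Real.pi / L : ℝ) * k * x) : ℂ) = ((-(2 * Real.pi / L * k * x) : ℝ) : ℂ) * I := by
    push_cast; ring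
  simp only [this]
  rw [Complex.exp_mul_I, ← Complex.ofReal_cos, ← Complex.ofReal_sin, Real.cos_neg, Real.sin_neg]
  push_cast
  ring

theorem fourierCoef_neg {L : ℝ} (hL : 0 < L) {f : ℝ → ℝ} (hf : IsL2 L f) (k : ℤ) :
    fourierCoef L (fun x => (f x : ℂ)) (-k) = conj (fourierCoef L (fun x => (f x : ℂ)) k) := by
  rw [fourierCoef_ofReal hL hf, fourierCoef_ofReal hL hf]
  simp [map_mul, intervalIntegral.integral_neg]

theorem iteratedDeriv_two_cos_mul (a : ℝ) :
    iteratedDeriv 2 (fun x => Real.cos (a * x)) = fun x => -a ^ 2 * Real.cos (a * x) := by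
  have h1 : deriv (fun x => Real.cos (a * x)) = fun x => -a * Real.sin (a * x) := by
    funext x
    have := ((hasDerivAt_id x).const_mul a).cos
    simpa [mul_comm] using this.deriv
  rw [iteratedDeriv_succ, iteratedDeriv_one, h1]
  funext x
  have := (((hasDerivAt_id x).const_mul a).sin).const_mul (-a)
  rw [mul_one] at this
  exact this.deriv.trans (by simp only [id]; ring)

theorem iteratedDeriv_two_sin_mul (a : ℝ) :
    iteratedDeriv 2 (fun x => Real.sin (a * x)) = fun x => -a ^ 2 * Real.sin (a * x) := by
  have h1 : deriv (fun x => Real.sin (a * x)) = fun x => a * Real.cos (a * x) := by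
    funext x
    have := ((hasDerivAt_id x).const_mul a).sin
    simpa [mul_comm] using this.deriv
  rw [iteratedDeriv_succ, iteratedDeriv_one, h1]
  funext x
  have := (((hasDerivAt_id x).const_mul a).cos).const_mul a
  rw [mul_one] at this
  exact this.deriv.trans (by simp only [id]; ring)

theorem mode_add_period {L : ℝ} (hL : 0 < L) (k : ℤ) (x : ℝ) :
    2 * Real.pi / L * k * (x + L) = 2 * Real.pi / L * k * x + k * (2 * Real.pi) := by
  field_simp

/-- Test functions are real, so the exponential mode is split into its cosine and sine parts, each
an eigenfunction of the second derivative. -/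
theorem fourierCoef_weakDeriv_two {L : ℝ} (hL : 0 < L) {f g : ℝ → ℝ} (hf : IsL2 L f)
    (hg : IsL2 L g) (hfg : HasWeakDeriv L 2 f g) (k : ℤ) :
    fourierCoef L (fun x => (g x : ℂ)) k
      = -((2 * Real.pi / L * k : ℝ) : ℂ) ^ 2 * fourierCoef L (fun x => (f x : ℂ)) k := by
  have hc := hfg (fun x => Real.cos (2 * Real.pi / L * k * x)) (by fun_prop)
    (fun x => by beta_reduce; rw [mode_add_period hL, Real.cos_add_int_mul_two_pi])
  have hs := hfg (fun x => Real.sin (2 * Real.pi / L * k * x)) (by fun_prop)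
    (fun x => by beta_reduce; rw [mode_add_period hL, Real.sin_add_int_mul_two_pi])
  rw [iteratedDeriv_two_cos_mul, neg_one_sq, one_mul] at hc
  rw [iteratedDeriv_two_sin_mul, neg_one_sq, one_mul] at hs
  simp only [mul_left_comm (f _), intervalIntegral.integral_const_mul] at hc hs
  rw [fourierCoef_ofReal hL hf, fourierCoef_ofReal hL hg, ← hc, ← hs]
  push_cast
  ring

/-- The continuously differentiable representative of an `H²` forcing, with its Fourier series. -/
theorem exists_representative {L : ℝ} (hL : 0 < L) {f : ℝ → ℝ} (hf : MemHDotPer L 2 f) :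
    ∃ c : ℤ → ℂ, c 0 = 0 ∧ (∀ k, c (-k) = conj (c k)) ∧
      (∃ A, ∀ k : ℤ, |(k : ℝ)| ^ 2 * ‖c k‖ ≤ A) ∧
      ContDiff ℝ 1 (fun x => (trigSum (2 * Real.pi / L) c x).re) ∧
      (fun x => (trigSum (2 * Real.pi / L) c x).re) =ᵐ[volume] f := by
  obtain ⟨g, -, hg, hfg⟩ := hf.weakDeriv 2 le_rfl
  set κ : ℝ := 2 * Real.pi / L with hκdef
  have hκ : 0 < κ := by positivity
  set c := fourierCoef L (fun x => (f x : ℂ)) with hcdef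
  have hsym : ∀ k, c (-k) = conj (c k) := fourierCoef_neg hL hf.isL2
  have hc0 : c 0 = 0 := by
    rw [hcdef, fourierCoef_ofReal hL hf.isL2]
    simp [hf.mean_zero]
  have hgL2 : MemLp (fun x => (g x : ℂ)) 2 (volume.restrict (Set.Ioc 0 L)) := hg.ofReal
  have hfL2 : MemLp (fun x => (f x : ℂ)) 2 (volume.restrict (Set.Ioc 0 L)) := hf.isL2.ofReal
  have hgs := (hasSum_sq_fourierCoef hL hgL2).summable
  have hgk : ∀ k : ℤ, ‖fourierCoef L (fun x => (g x : ℂ)) k‖ = κ ^ 2 * (|(k : ℝ)| ^ 2 * ‖c k‖) := by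
    intro k
    rw [fourierCoef_weakDeriv_two hL hf.isL2 hg hfg, norm_mul, norm_neg, norm_pow, Complex.norm_real,
      Real.norm_eq_abs, abs_mul, ← hκdef, abs_of_pos hκ]
    ring
  have hA : ∃ A, ∀ k : ℤ, |(k : ℝ)| ^ 2 * ‖c k‖ ≤ A := by
    -- Each coefficient `y` of the second weak derivative satisfies `y ≤ 1 + y²`, and `y²` is at
    -- most the Parseval sum.
    refine ⟨(1 + ∑' k, ‖fourierCoef L (fun x => (g x : ℂ)) k‖ ^ 2) / κ ^ 2, fun k => ?_⟩
    rw [le_div_iff₀ (by positivity), mul_comm, ← hgk]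
    have := hgs.le_tsum k fun _ _ => by positivity
    nlinarith [sq_nonneg (‖fourierCoef L (fun x => (g x : ℂ)) k‖ - 1)]
  obtain ⟨A, hA⟩ := hA
  have hs0 := summable_norm_of_pow_mul_le hc0 one_lt_two hA
  -- Boundedness of `k² cₖ` would not suffice. Here `k cₖ` is, up to a constant, the product of the
  -- two square-summable sequences `k² cₖ` and `1 / k`.
  have hs1 : Summable fun k => ‖derivCoeff κ c k‖ := by
    refine Summable.of_nonneg_of_le (fun _ => norm_nonneg _) (fun k => ?_)
      ((hgs.add (summable_const_div_int_pow 1 one_lt_two)).mul_left (1 / κ))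
    rw [norm_derivCoeff hκ, hgk]
    rcases eq_or_ne k 0 with rfl | hk
    · simp
    have hx := one_le_abs_intCast hk
    set x := |(k : ℝ)|
    set y := κ ^ 2 * (x ^ 2 * ‖c k‖) with hy
    have hx0 : 0 < x := lt_of_lt_of_le one_pos hx
    have e : κ * x * ‖c k‖ = 1 / κ * (y * (1 / x)) := by
      rw [hy]; field_simp
    rw [e]
    gcongr
    have h1 : 1 / x ^ 2 = (1 / x) ^ 2 := by rw [one_div_pow]
    rw [h1]
    nlinarith [sq_nonneg (y - 1 / x), sq_nonneg y, sq_nonneg (1 / x)]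
  have hd := fun x => (hasDerivAt_trigSum hs0 hs1 x).complex_re
  refine ⟨c, hc0, hsym, ⟨A, hA⟩, ?_, ?_⟩
  · rw [contDiff_one_iff_deriv]
    refine ⟨fun x => (hd x).differentiableAt, ?_⟩
    rw [show deriv (fun x => (trigSum κ c x).re) = fun x => (trigSum κ (derivCoeff κ c) x).re from
      funext fun x => (hd x).deriv]
    exact Complex.continuous_re.comp (continuous_trigSum hs1)
  · have hcont := continuous_trigSum (κ := κ) hs0
    have hFper : Function.Periodic (trigSum κ c) L := by
      have := periodic_trigSum hκ.ne' c
      have e : 2 * Real.pi / κ = L := by rw [hκdef]; field_simp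
      rwa [e] at this
    have hFL2 : MemLp (trigSum κ c) 2 (volume.restrict (Set.Ioc 0 L)) := by
      refine MemLp.of_bound hcont.aestronglyMeasurable (∑' k, ‖c k‖) (Eventually.of_forall fun x => ?_)
      exact tsum_of_norm_bounded hs0.hasSum fun k => (norm_mul_cexp_mode _ _ _ x).le
    have hz := ae_eq_zero_of_fourierCoef_eq_zero hL (h := fun x => trigSum κ c x - (f x : ℂ))
      (fun x => by beta_reduce; rw [hFper x, hf.periodic x]) (hFL2.sub hfL2) (fun k => by
        have h1 := fourierCoef_trigSum hL hs0 k
        have h2 : fourierCoef L (fun x => (f x : ℂ)) k = c k := rfl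
        rw [← hκdef] at h1
        rw [← sub_eq_zero.2 (h1.trans h2.symm)]
        simp only [fourierCoef]
        rw [← mul_sub, ← intervalIntegral.integral_sub]
        · simp only [sub_mul]
        · exact (intervalIntegrable_of_memLp_two hL hFL2).mul_continuousOn (by fun_prop)
        · exact (intervalIntegrable_of_memLp_two hL hfL2).mul_continuousOn (by fun_prop))
    filter_upwards [hz] with x hx
    have : trigSum κ c x = (f x : ℂ) := sub_eq_zero.1 hx
    rw [this, Complex.ofReal_re]

end Forcing

/-! ### A priori bounds for classical periodic solutions. -/

section Estimates

open Filter Topology PeriodicKdV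

theorem HasDerivAt.periodic_deriv {u v : ℝ → ℝ} {L : ℝ} (hu : Function.Periodic u L)
    (h : ∀ x, HasDerivAt u (v x) x) : Function.Periodic v L := by
  intro x
  have h1 : HasDerivAt (fun y => u (y + L)) (v (x + L)) x := (h (x + L)).comp_add_const x L
  rw [show (fun y => u (y + L)) = u from funext hu] at h1
  exact h1.unique (h x)

theorem integral_deriv_eq_zero_of_periodic {u v : ℝ → ℝ} {L : ℝ} (hu : Function.Periodic u L)
    (h : ∀ x, HasDerivAt u (v x) x) (hv : Continuous v) : ∫ x in (0 : ℝ)..L, v x = 0 := by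
  rw [intervalIntegral.integral_eq_sub_of_hasDerivAt (fun x _ => h x) (hv.intervalIntegrable _ _)]
  have := hu 0
  rw [zero_add] at this
  rw [this, sub_self]

theorem sq_l2Norm {L : ℝ} (hL : 0 ≤ L) (u : ℝ → ℝ) :
    l2Norm L u ^ 2 = ∫ x in (0 : ℝ)..L, u x ^ 2 :=
  Real.sq_sqrt (intervalIntegral.integral_nonneg hL fun _ _ => sq_nonneg _)

theorem l2Norm_nonneg (L : ℝ) (u : ℝ → ℝ) : 0 ≤ l2Norm L u := Real.sqrt_nonneg _

theorem abs_integral_mul_le_l2Norm {L : ℝ} (hL : 0 ≤ L) {a b : ℝ → ℝ} (ha : Continuous a)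
    (hb : Continuous b) : |∫ x in (0 : ℝ)..L, a x * b x| ≤ l2Norm L a * l2Norm L b := by
  have hq : ∀ t : ℝ, 0 ≤ l2Norm L a ^ 2 * (t * t) + 2 * (∫ x in (0 : ℝ)..L, a x * b x) * t
      + l2Norm L b ^ 2 := by
    intro t
    have h0 : 0 ≤ ∫ x in (0 : ℝ)..L, (t * a x + b x) ^ 2 :=
      intervalIntegral.integral_nonneg hL fun _ _ => sq_nonneg _
    have h1 : ∫ x in (0 : ℝ)..L, (t * a x + b x) ^ 2
        = ∫ x in (0 : ℝ)..L, (t * t * a x ^ 2 + 2 * t * (a x * b x) + b x ^ 2) :=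
      intervalIntegral.integral_congr fun x _ => by ring
    have i1 : IntervalIntegrable (fun x => t * t * a x ^ 2) volume 0 L :=
      Continuous.intervalIntegrable (by fun_prop) _ _
    have i2 : IntervalIntegrable (fun x => 2 * t * (a x * b x)) volume 0 L :=
      Continuous.intervalIntegrable (by fun_prop) _ _
    have i3 : IntervalIntegrable (fun x => b x ^ 2) volume 0 L :=
      Continuous.intervalIntegrable (by fun_prop) _ _
    rw [h1, intervalIntegral.integral_add (i1.add i2) i3, intervalIntegral.integral_add i1 i2,
      intervalIntegral.integral_const_mul, intervalIntegral.integral_const_mul, ← sq_l2Norm hL,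
      ← sq_l2Norm hL] at h0
    linarith
  have hdis := discrim_le_zero hq
  rw [discrim] at hdis
  refine abs_le_of_sq_le_sq ?_ (mul_nonneg (l2Norm_nonneg _ _) (l2Norm_nonneg _ _))
  nlinarith

/-- Rolle's theorem for the primitive, which takes equal values at both ends. -/
theorem exists_zero_of_integral_eq_zero {L : ℝ} (hL : 0 < L) {u : ℝ → ℝ} (hu : Continuous u)
    (h0 : ∫ x in (0 : ℝ)..L, u x = 0) : ∃ x ∈ Set.Icc 0 L, u x = 0 := by
  have hd : ∀ x, HasDerivAt (fun y => ∫ t in (0 : ℝ)..y, u t) (u x) x := fun x =>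
    intervalIntegral.integral_hasDerivAt_right (hu.intervalIntegrable _ _)
      (hu.stronglyMeasurableAtFilter _ _) hu.continuousAt
  obtain ⟨x, hx, hx0⟩ := exists_hasDerivAt_eq_zero hL
    (fun x _ => (hd x).continuousAt.continuousWithinAt) (by simp [h0]) fun x _ => hd x
  exact ⟨x, Set.Ioo_subset_Icc_self hx, hx0⟩

/-- Agmon's inequality for functions of mean zero. -/
theorem sq_le_two_mul_l2Norm_mul {L : ℝ} (hL : 0 < L) {u v : ℝ → ℝ}
    (h : ∀ x, HasDerivAt u (v x) x) (hv : Continuous v) (h0 : ∫ x in (0 : ℝ)..L, u x = 0)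
    {x : ℝ} (hx : x ∈ Set.Icc 0 L) : u x ^ 2 ≤ 2 * (l2Norm L u * l2Norm L v) := by
  have hu : Continuous u := continuous_iff_continuousAt.2 fun x => (h x).continuousAt
  obtain ⟨y, hy, hy0⟩ := exists_zero_of_integral_eq_zero hL hu h0
  have hd : ∀ x, HasDerivAt (fun z => u z ^ 2) (2 * (u x * v x)) x := fun x => by
    refine ((h x).pow 2).congr_deriv ?_
    simp; ring
  have h1 := intervalIntegral.integral_eq_sub_of_hasDerivAt (a := y) (b := x) (fun x _ => hd x)
    (Continuous.intervalIntegrable (by fun_prop) _ _)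
  rw [hy0, zero_pow two_ne_zero, sub_zero, intervalIntegral.integral_const_mul] at h1
  -- Integrating from a zero `y` of `u` gives `u(x)² = 2 ∫ u u'`; the path from `y` to `x` stays
  -- inside one period.
  have h2 : |∫ z in y..x, u z * v z| ≤ ∫ z in (0 : ℝ)..L, |u z| * |v z| := by
    rw [← Real.norm_eq_abs]
    refine intervalIntegral.norm_integral_le_integral_norm_uIoc.trans ?_
    rw [intervalIntegral.integral_of_le hL.le]
    simp only [norm_mul, Real.norm_eq_abs]
    refine setIntegral_mono_set ?_ (Eventually.of_forall fun z => by positivity) ?_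
    · exact (Continuous.integrableOn_Icc (by fun_prop)).mono_set Set.Ioc_subset_Icc_self
    · refine LE.le.eventuallyLE ?_
      intro z hz
      rcases Set.mem_uIoc.1 hz with hz | hz
      · exact ⟨hy.1.trans_lt hz.1, hz.2.trans hx.2⟩
      · exact ⟨hx.1.trans_lt hz.1, hz.2.trans hy.2⟩
  have h3 := abs_integral_mul_le_l2Norm hL.le hu.abs hv.abs
  have h4 : ∀ w : ℝ → ℝ, l2Norm L (fun z => |w z|) = l2Norm L w := fun w => by
    simp only [l2Norm, sq_abs]
  rw [h4, h4] at h3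
  have h5 := le_abs_self (∫ z in (0 : ℝ)..L, |u z| * |v z|)
  have h6 := le_abs_self (∫ z in y..x, u z * v z)
  linarith

/-- The a priori bounds for a classical periodic steady state of mean zero. -/
theorem steadyState_bounds {L γ : ℝ} (hL : 0 < L) (hγ : 0 < γ) {u u₁ u₂ u₃ f : ℝ → ℝ}
    (hper : Function.Periodic u L) (h1 : ∀ x, HasDerivAt u (u₁ x) x)
    (h2 : ∀ x, HasDerivAt u₁ (u₂ x) x) (h3 : ∀ x, HasDerivAt u₂ (u₃ x) x) (hc3 : Continuous u₃)
    (hf : Continuous f) (hf0 : ∫ x in (0 : ℝ)..L, f x = 0)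
    (heq : ∀ x, u x * u₁ x + u₃ x + γ * u x = f x) :
    (∫ x in (0 : ℝ)..L, u x = 0) ∧ l2Norm L u ≤ l2Norm L f / γ ∧
      l2Norm L u₃ ^ 2 ≤ 16 * (l2Norm L f / γ) ^ 6 + 4 * l2Norm L f ^ 2 := by
  have hc0 : Continuous u := continuous_iff_continuousAt.2 fun x => (h1 x).continuousAt
  have hc1 : Continuous u₁ := continuous_iff_continuousAt.2 fun x => (h2 x).continuousAt
  have hc2 : Continuous u₂ := continuous_iff_continuousAt.2 fun x => (h3 x).continuousAt
  have hp1 := HasDerivAt.periodic_deriv hper h1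
  have hp2 := HasDerivAt.periodic_deriv hp1 h2
  have hii : ∀ g : ℝ → ℝ, Continuous g → IntervalIntegrable g volume 0 L :=
    fun g hg => hg.intervalIntegrable _ _
  have hmean : ∫ x in (0 : ℝ)..L, u x = 0 := by
    have hz := integral_deriv_eq_zero_of_periodic (L := L) (u := fun x => u x ^ 2 / 2 + u₂ x)
      (v := fun x => u x * u₁ x + u₃ x) (fun x => by simp only [hper x, hp2 x])
      (fun x => by
        refine (((h1 x).pow 2).div_const 2).add (h3 x) |>.congr_deriv ?_
        simp; ring) (by fun_prop)
    have hs : ∫ x in (0 : ℝ)..L, f x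
        = (∫ x in (0 : ℝ)..L, (u x * u₁ x + u₃ x)) + γ * ∫ x in (0 : ℝ)..L, u x := by
      rw [← intervalIntegral.integral_const_mul, ← intervalIntegral.integral_add
        (hii _ (by fun_prop)) (hii _ (by fun_prop))]
      exact intervalIntegral.integral_congr fun x _ => (heq x).symm
    rw [hf0, hz, zero_add] at hs
    exact (mul_eq_zero.1 hs.symm).resolve_left hγ.ne'
  -- The integrations by parts are obtained by integrating exact derivatives of periodic functions.
  have hcube := integral_deriv_eq_zero_of_periodic (L := L) (u := fun x => u x ^ 3 / 3)
      (v := fun x => u x * (u x * u₁ x)) (fun x => by simp only [hper x])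
      (fun x => by
        refine (((h1 x).pow 3).div_const 3) |>.congr_deriv ?_
        simp; ring) (by fun_prop)
  have hu3 := integral_deriv_eq_zero_of_periodic (L := L) (u := fun x => u x * u₂ x - u₁ x ^ 2 / 2)
      (v := fun x => u x * u₃ x) (fun x => by simp only [hper x, hp1 x, hp2 x])
      (fun x => by
        refine ((h1 x).mul (h3 x)).sub (((h2 x).pow 2).div_const 2) |>.congr_deriv ?_
        simp; ring) (by fun_prop)
  have hu2 := integral_deriv_eq_zero_of_periodic (L := L) (u := fun x => u x * u₁ x)
      (v := fun x => u₁ x ^ 2 + u x * u₂ x) (fun x => by simp only [hper x, hp1 x])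
      (fun x => by
        refine (h1 x).mul (h2 x) |>.congr_deriv ?_
        ring) (by fun_prop)
  have hu13 := integral_deriv_eq_zero_of_periodic (L := L) (u := fun x => u₁ x * u₂ x)
      (v := fun x => u₂ x ^ 2 + u₁ x * u₃ x) (fun x => by simp only [hp1 x, hp2 x])
      (fun x => by
        refine (h2 x).mul (h3 x) |>.congr_deriv ?_
        ring) (by fun_prop)
  set U := l2Norm L u with hU
  set U1 := l2Norm L u₁ with hU1
  set U2 := l2Norm L u₂ with hU2
  set X := l2Norm L u₃ with hX
  set F := l2Norm L f with hF
  set Y := l2Norm L (fun x => u x * u₁ x) with hY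
  have U0 : 0 ≤ U := l2Norm_nonneg _ _
  have U10 : 0 ≤ U1 := l2Norm_nonneg _ _
  have U20 : 0 ≤ U2 := l2Norm_nonneg _ _
  have X0 : 0 ≤ X := l2Norm_nonneg _ _
  have F0 : 0 ≤ F := l2Norm_nonneg _ _
  have Y0 : 0 ≤ Y := l2Norm_nonneg _ _
  have hUF : U ≤ F / γ := by
    have e : ∫ x in (0 : ℝ)..L, u x * f x = γ * U ^ 2 := by
      have : ∫ x in (0 : ℝ)..L, u x * f x = (∫ x in (0 : ℝ)..L, u x * (u x * u₁ x))
          + (∫ x in (0 : ℝ)..L, u x * u₃ x) + γ * ∫ x in (0 : ℝ)..L, u x ^ 2 := by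
        rw [← intervalIntegral.integral_const_mul, ← intervalIntegral.integral_add
          (hii _ (by fun_prop)) (hii _ (by fun_prop)), ← intervalIntegral.integral_add
          (hii _ (by fun_prop)) (hii _ (by fun_prop))]
        exact intervalIntegral.integral_congr fun x _ => by simp only [← heq x]; ring
      rw [this, hcube, hu3, sq_l2Norm hL.le]; ring
    have cs := (le_abs_self _).trans (abs_integral_mul_le_l2Norm hL.le hc0 hf)
    rw [e] at cs
    rw [le_div_iff₀ hγ]
    rcases U0.eq_or_lt with h | h
    · rw [← h, zero_mul]; exact F0
    · refine le_of_mul_le_mul_left ?_ h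
      linarith
  have hI1 : U1 ^ 2 ≤ U * U2 := by
    rw [intervalIntegral.integral_add (hii _ (by fun_prop)) (hii _ (by fun_prop)),
      ← sq_l2Norm hL.le] at hu2
    have cs := (neg_le_abs _).trans (abs_integral_mul_le_l2Norm hL.le hc0 hc2)
    linarith
  have hI2 : U2 ^ 2 ≤ U1 * X := by
    rw [intervalIntegral.integral_add (hii _ (by fun_prop)) (hii _ (by fun_prop)),
      ← sq_l2Norm hL.le] at hu13
    have cs := (neg_le_abs _).trans (abs_integral_mul_le_l2Norm hL.le hc1 hc3)
    linarith
  -- Interpolation between `u` and `u_xxx`: eliminate `U2` from the two preceding inequalities.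
  have hI3 : U1 ^ 3 ≤ U ^ 2 * X := by
    rcases U10.eq_or_lt with h | h
    · rw [← h, zero_pow three_ne_zero]; positivity
    · refine le_of_mul_le_mul_left ?_ h
      calc U1 * U1 ^ 3 = (U1 ^ 2) ^ 2 := by ring
        _ ≤ (U * U2) ^ 2 := by gcongr
        _ = U ^ 2 * U2 ^ 2 := by ring
        _ ≤ U ^ 2 * (U1 * X) := by gcongr
        _ = U1 * (U ^ 2 * X) := by ring
  have hYX : Y ^ 2 ≤ 2 * U ^ 3 * X := by
    have hle : Y ^ 2 ≤ 2 * (U * U1) * U1 ^ 2 := by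
      rw [hY, sq_l2Norm hL.le, hU1, sq_l2Norm hL.le, ← intervalIntegral.integral_const_mul]
      refine intervalIntegral.integral_mono_on hL.le (hii _ (by fun_prop)) (hii _ (by fun_prop))
        fun x hx => ?_
      rw [mul_pow]
      gcongr
      exact sq_le_two_mul_l2Norm_mul hL h1 hc1 hmean hx
    calc Y ^ 2 ≤ 2 * U * U1 ^ 3 := by linarith
      _ ≤ 2 * U * (U ^ 2 * X) := by gcongr
      _ = 2 * U ^ 3 * X := by ring
  -- Testing with `u_xxx` removes the damping term, because `∫ u u_xxx = 0`.
  have hXFY : X ≤ F + Y := by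
    have e : X ^ 2 = (∫ x in (0 : ℝ)..L, u₃ x * f x)
        - ∫ x in (0 : ℝ)..L, u₃ x * (u x * u₁ x) := by
      have : ∫ x in (0 : ℝ)..L, u₃ x ^ 2 = (∫ x in (0 : ℝ)..L, u₃ x * f x)
          - (∫ x in (0 : ℝ)..L, u₃ x * (u x * u₁ x)) - γ * ∫ x in (0 : ℝ)..L, u x * u₃ x := by
        rw [← intervalIntegral.integral_const_mul, ← intervalIntegral.integral_sub
          (hii _ (by fun_prop)) (hii _ (by fun_prop)), ← intervalIntegral.integral_sub
          (hii _ (by fun_prop)) (hii _ (by fun_prop))]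
        exact intervalIntegral.integral_congr fun x _ => by simp only [← heq x]; ring
      rw [hX, sq_l2Norm hL.le, this, hu3]; ring
    have cs1 := (le_abs_self _).trans (abs_integral_mul_le_l2Norm hL.le hc3 hf)
    have cs2 := (neg_le_abs _).trans (abs_integral_mul_le_l2Norm hL.le hc3 (hc0.mul hc1))
    change _ ≤ X * Y at cs2
    change _ ≤ X * F at cs1
    simp only [Pi.mul_apply] at cs2
    rcases X0.eq_or_lt with h | h
    · rw [← h]; exact add_nonneg F0 Y0
    · refine le_of_mul_le_mul_left ?_ h
      linarith
  refine ⟨hmean, hUF, ?_⟩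
  have hU6 : U ^ 6 ≤ (F / γ) ^ 6 := by gcongr
  have a1 : X ^ 2 ≤ 2 * F ^ 2 + 2 * Y ^ 2 := by nlinarith [sq_nonneg (F - Y)]
  -- `X² ≤ 2F² + 4U³X` and `4U³X ≤ X²/2 + 8U⁶`; absorbing `X²/2` gives the constants `16` and `4`.
  nlinarith [sq_nonneg (X - 4 * U ^ 3)]

end Estimates

/-! ### Weak derivatives up to order five. -/

section Membership

open Filter Topology PeriodicKdV

theorem isL2_of_continuous {L : ℝ} {v : ℝ → ℝ} (hv : Continuous v) : IsL2 L v := by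
  obtain ⟨C, hC⟩ := (isCompact_Icc (a := (0 : ℝ)) (b := L)).exists_bound_of_continuousOn
    hv.continuousOn
  refine MemLp.of_bound hv.aestronglyMeasurable C ?_
  exact (ae_restrict_iff' measurableSet_Ioc).2
    (Eventually.of_forall fun x hx => hC x (Set.Ioc_subset_Icc_self hx))

theorem IsL2.sub {L : ℝ} {v w : ℝ → ℝ} (hv : IsL2 L v) (hw : IsL2 L w) :
    IsL2 L (fun x => v x - w x) :=
  MemLp.sub hv hw

theorem iteratedDeriv_periodic {φ : ℝ → ℝ} {L : ℝ} (hφ : Function.Periodic φ L) (n : ℕ) :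
    Function.Periodic (iteratedDeriv n φ) L := by
  intro x
  have := congrFun (iteratedDeriv_comp_add_const n φ L) x
  rw [show (fun z => φ (z + L)) = φ from funext hφ] at this
  exact this.symm

theorem hasWeakDeriv_zero (L : ℝ) (u : ℝ → ℝ) : HasWeakDeriv L 0 u u := fun φ _ _ => by
  simp

/-- One integration by parts, whose boundary terms cancel by periodicity; it peels classical
derivatives off a weak one. -/
theorem HasWeakDeriv.succ_of_hasDerivAt {L : ℝ} {u u' v : ℝ → ℝ} {j : ℕ}
    (hu : Function.Periodic u L) (h : ∀ x, HasDerivAt u (u' x) x) (hc : Continuous u')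
    (hw : HasWeakDeriv L j u' v) : HasWeakDeriv L (j + 1) u v := by
  intro φ hφ hper
  have hd : ∀ x, HasDerivAt (iteratedDeriv j φ) (iteratedDeriv (j + 1) φ x) x := by
    intro x
    rw [iteratedDeriv_succ]
    exact ((hφ.differentiable_iteratedDeriv j (by exact_mod_cast WithTop.coe_lt_top _)) x).hasDerivAt
  have hcφ : Continuous (iteratedDeriv (j + 1) φ) :=
    hφ.continuous_iteratedDeriv (j + 1) (by exact_mod_cast le_top)
  rw [intervalIntegral.integral_mul_deriv_eq_deriv_mul (fun x _ => h x) (fun x _ => hd x)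
    (hc.intervalIntegrable _ _) (hcφ.intervalIntegrable _ _), hw φ hφ hper]
  have h1 := hu 0
  have h2 := iteratedDeriv_periodic hper j 0
  rw [zero_add] at h1 h2
  rw [h1, h2]
  ring

theorem HasWeakDeriv.sub {L : ℝ} (hL : 0 < L) {u v u' v' : ℝ → ℝ} {j : ℕ} (hu : IsL2 L u)
    (hv : IsL2 L v) (hu' : IsL2 L u') (hv' : IsL2 L v') (h : HasWeakDeriv L j u u')
    (h' : HasWeakDeriv L j v v') : HasWeakDeriv L j (fun x => u x - v x) (fun x => u' x - v' x) := by
  intro φ hφ hper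
  have hcj : Continuous (iteratedDeriv j φ) :=
    hφ.continuous_iteratedDeriv j (by exact_mod_cast le_top)
  have hc : Continuous φ := hφ.continuous
  simp only [sub_mul]
  rw [intervalIntegral.integral_sub
      ((IsL2.intervalIntegrable hL hu).mul_continuousOn hcj.continuousOn)
      ((IsL2.intervalIntegrable hL hv).mul_continuousOn hcj.continuousOn),
    intervalIntegral.integral_sub
      ((IsL2.intervalIntegrable hL hu').mul_continuousOn hc.continuousOn)
      ((IsL2.intervalIntegrable hL hv').mul_continuousOn hc.continuousOn),
    h φ hφ hper, h' φ hφ hper]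
  ring

theorem HasWeakDeriv.congr_ae {L : ℝ} {u v w : ℝ → ℝ} {j : ℕ} (h : HasWeakDeriv L j u w)
    (huv : v =ᵐ[volume] u) : HasWeakDeriv L j v w := by
  intro φ hφ hper
  rw [← h φ hφ hper]
  refine intervalIntegral.integral_congr_ae ?_
  filter_upwards [huv] with x hx _
  rw [hx]

theorem memHDotPer_five_of_steadyState {L γ : ℝ} (hL : 0 < L) {u u₁ u₂ u₃ f F : ℝ → ℝ}
    (hper : Function.Periodic u L) (h1 : ∀ x, HasDerivAt u (u₁ x) x)
    (h2 : ∀ x, HasDerivAt u₁ (u₂ x) x) (h3 : ∀ x, HasDerivAt u₂ (u₃ x) x) (hc3 : Continuous u₃)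
    (hF : Continuous F) (hFf : F =ᵐ[volume] f) (hf : MemHDotPer L 2 f)
    (heq : ∀ x, u x * u₁ x + u₃ x + γ * u x = F x) (h0 : ∫ x in (0 : ℝ)..L, u x = 0) :
    MemHDotPer L 5 u := by
  have hc0 : Continuous u := continuous_iff_continuousAt.2 fun x => (h1 x).continuousAt
  have hc1 : Continuous u₁ := continuous_iff_continuousAt.2 fun x => (h2 x).continuousAt
  have hc2 : Continuous u₂ := continuous_iff_continuousAt.2 fun x => (h3 x).continuousAt
  have hp1 := HasDerivAt.periodic_deriv hper h1
  have hp2 := HasDerivAt.periodic_deriv hp1 h2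
  have hp3 := HasDerivAt.periodic_deriv hp2 h3
  let q : ℝ → ℝ := fun x => u x * u₁ x + γ * u x
  let q₁ : ℝ → ℝ := fun x => u₁ x ^ 2 + u x * u₂ x + γ * u₁ x
  let q₂ : ℝ → ℝ := fun x => 3 * (u₁ x * u₂ x) + u x * u₃ x + γ * u₂ x
  have hq : ∀ x, HasDerivAt q (q₁ x) x := fun x => by
    refine (((h1 x).mul (h2 x)).add ((h1 x).const_mul γ)).congr_deriv ?_
    simp only [q₁]; ring
  have hq1 : ∀ x, HasDerivAt q₁ (q₂ x) x := fun x => by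
    refine ((((h2 x).pow 2).add ((h1 x).mul (h3 x))).add ((h2 x).const_mul γ)).congr_deriv ?_
    simp only [q₂, Nat.cast_ofNat, Nat.add_one_sub_one, pow_one]; ring
  have cq : Continuous q := by fun_prop
  have cq1 : Continuous q₁ := by fun_prop
  have cq2 : Continuous q₂ := by fun_prop
  have pq : Function.Periodic q L := fun x => by simp only [q, hper x, hp1 x]
  have pq1 := HasDerivAt.periodic_deriv pq hq
  have pq2 := HasDerivAt.periodic_deriv pq1 hq1
  have hu3 : u₃ = fun x => F x - q x := funext fun x => by simp only [q, ← heq x]; ring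
  -- Three classical derivatives reduce order `j + 3` of `u` to order `j` of `F - q`, where `q` is
  -- classically `C²` and `F` inherits the weak derivatives of `f`.
  have key : ∀ (j : ℕ) (qj : ℝ → ℝ), j ≤ 2 → Continuous qj → Function.Periodic qj L →
      HasWeakDeriv L j q qj →
      ∃ v, Function.Periodic v L ∧ IsL2 L v ∧ HasWeakDeriv L (j + 3) u v := by
    intro j qj hj hcj hpj hwj
    obtain ⟨w, hwp, hwL, hw⟩ := hf.weakDeriv j hj
    refine ⟨fun x => w x - qj x, fun x => by simp only [hwp x, hpj x],
      IsL2.sub hwL (isL2_of_continuous hcj), ?_⟩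
    refine HasWeakDeriv.succ_of_hasDerivAt hper h1 hc1 (HasWeakDeriv.succ_of_hasDerivAt hp1 h2 hc2
      (HasWeakDeriv.succ_of_hasDerivAt hp2 h3 hc3 ?_))
    rw [hu3]
    exact HasWeakDeriv.sub hL (isL2_of_continuous hF) (isL2_of_continuous cq) hwL
      (isL2_of_continuous hcj) (HasWeakDeriv.congr_ae hw hFf) hwj
  refine ⟨hper, isL2_of_continuous hc0, h0, fun j hj => ?_⟩
  interval_cases j
  · exact ⟨u, hper, isL2_of_continuous hc0, hasWeakDeriv_zero L u⟩
  · exact ⟨u₁, hp1, isL2_of_continuous hc1,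
      HasWeakDeriv.succ_of_hasDerivAt hper h1 hc1 (hasWeakDeriv_zero L u₁)⟩
  · exact ⟨u₂, hp2, isL2_of_continuous hc2, HasWeakDeriv.succ_of_hasDerivAt hper h1 hc1
      (HasWeakDeriv.succ_of_hasDerivAt hp1 h2 hc2 (hasWeakDeriv_zero L u₂))⟩
  · exact key 0 q (by norm_num) cq pq (hasWeakDeriv_zero L q)
  · exact key 1 q₁ (by norm_num) cq1 pq1
      (HasWeakDeriv.succ_of_hasDerivAt pq hq cq1 (hasWeakDeriv_zero L q₁))
  · exact key 2 q₂ le_rfl cq2 pq2 (HasWeakDeriv.succ_of_hasDerivAt pq hq cq1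
      (HasWeakDeriv.succ_of_hasDerivAt pq1 hq1 cq2 (hasWeakDeriv_zero L q₂)))

end Membership

/-! ### Assembly of the existence theorem. -/

theorem mainTheorem7 :
    ∃ c : ℝ, 0 < c ∧
      ∀ L : ℝ, 0 < L → ∀ γ : ℝ, 0 < γ →
        ∀ f : ℝ → ℝ, PeriodicKdV.MemHDotPer L 2 f →
          ∃ u f' : ℝ → ℝ,
            PeriodicKdV.MemHDotPer L 5 u ∧
            -- `f'` is the continuously differentiable representative of `f`
            ContDiff ℝ 1 f' ∧ f' =ᵐ[MeasureTheory.volume] f ∧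
            PeriodicKdV.IsClassicalSteadyState γ f' u ∧
            PeriodicKdV.l2Norm L u ≤ PeriodicKdV.l2Norm L f / γ ∧
            PeriodicKdV.l2Norm L (iteratedDeriv 3 u) ^ 2 ≤
              2 * c * (PeriodicKdV.l2Norm L f / γ) ^ 6 + 16 * PeriodicKdV.l2Norm L f ^ 2 := by
  -- `2 * 8` is the coefficient `16` of the sixth power in `steadyState_bounds`; its `4 |f|²` is
  -- below the allowed `16 |f|²`.
  refine ⟨8, by norm_num, fun L hL γ hγ f hf => ?_⟩
  obtain ⟨c, hc0, hsym, ⟨A, hA⟩, hF1, hFf⟩ := exists_representative hL hf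
  have hκ : 0 < 2 * Real.pi / L := by positivity
  obtain ⟨u, u₁, u₂, u₃, hper, h1, h2, h3, hc3, heq⟩ :=
    exists_classical_solution hκ hγ hc0 hsym hA
  rw [show 2 * Real.pi / (2 * Real.pi / L) = L by field_simp] at hper
  set F : ℝ → ℝ := fun x => (trigSum (2 * Real.pi / L) c x).re
  have hint : ∀ g : ℝ → ℝ, ∫ x in (0 : ℝ)..L, g (F x) = ∫ x in (0 : ℝ)..L, g (f x) := fun g => by
    refine intervalIntegral.integral_congr_ae ?_
    filter_upwards [hFf] with x hx _
    rw [hx]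
  have hnorm : PeriodicKdV.l2Norm L F = PeriodicKdV.l2Norm L f :=
    congrArg Real.sqrt (hint fun y => y ^ 2)
  obtain ⟨hmean, hU, hX⟩ := steadyState_bounds hL hγ hper h1 h2 h3 hc3 hF1.continuous
    ((hint fun y => y).trans hf.mean_zero) heq
  rw [hnorm] at hU hX
  have d1 : deriv u = u₁ := funext fun x => (h1 x).deriv
  have d2 : deriv u₁ = u₂ := funext fun x => (h2 x).deriv
  have d3 : deriv u₂ = u₃ := funext fun x => (h3 x).deriv
  have hiter : iteratedDeriv 3 u = u₃ := by
    rw [iteratedDeriv_succ, iteratedDeriv_succ, iteratedDeriv_one, d1, d2, d3]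
  have hC3 : ContDiff ℝ 3 u := by
    have k2 : ContDiff ℝ 1 u₂ :=
      contDiff_one_iff_deriv.2 ⟨fun x => (h3 x).differentiableAt, d3 ▸ hc3⟩
    have k1 : ContDiff ℝ (1 + 1) u₁ := contDiff_succ_iff_deriv.2
      ⟨fun x => (h2 x).differentiableAt, by simp, d2 ▸ k2⟩
    have k0 : ContDiff ℝ (1 + 1 + 1) u := contDiff_succ_iff_deriv.2
      ⟨fun x => (h1 x).differentiableAt, by simp, d1 ▸ k1⟩
    norm_num at k0
    exact k0
  refine ⟨u, F, memHDotPer_five_of_steadyState hL hper h1 h2 h3 hc3 hF1.continuous hFf hf heq hmean,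
    hF1, hFf, ⟨hC3, fun x => ?_⟩, hU, ?_⟩
  · rw [d1, hiter]; exact heq x
  · rw [hiter]
    nlinarith [sq_nonneg (PeriodicKdV.l2Norm L f)]
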